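/- Let $n\ge 1$, $\gamma\in(0,1)$ and $c\ge 0$. Consider $n$ channels whose states $X_1(t),\dots,X_n(t)\in\{0,1\}$ ($1$ = good, $0$ = bad) evolve independently, each as a continuous-time Markov chain that jumps from $0$ to $1$ at rate $1$ and from $1$ to $0$ at rate $1/\gamma-1$; the initial states are arbitrary. A controller who observes all channels uses channel $U(t)\in\{1,\dots,n\}$ at time $t$. A policy is any piecewise constant (càdlàg), non-anticipating choice of $U$, possibly randomized, starting from an arbitrary channel $U(0^-)$. With $N(t)$ the number of channel changes in $[0,t]$, its expected average reward is $$g=\liminf_{t\to\infty}\frac1t\left(\mathbb E\int_0^t X_{U(s)}(s)\,ds-c\,\mathbb E N(t)\right)\in[-\infty,\infty).$$ Let $\pi^{(s)}$ be the policy of never switching, and let $\pi^{(a)}$ be the policy that switches, whenever the current channel is bad and some channel is good, immediately to an (arbitrarily chosen) good channel, and does not switch otherwise. Both policies can be followed from every initial channel, and the following hold. 1. The better of the two policies is $$\pi^*=\begin{cases}\pi^{(a)}, & c<\gamma,\\ \pi^{(s)}, & c\ge\gamma.\end{cases}$$ That is, the expected average reward of $\pi^{(a)}$ is at least that of $\pi^{(s)}$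 if $c<\gamma$ (strictly larger if moreover $n\ge2$), and at most that of $\pi^{(s)}$ if $c\ge\gamma$. 2. The expected average reward under $\pi^*$ is $$g^*=\begin{cases}1-(1-\gamma)^n-c\,\dfrac{1-\gamma-(1-\gamma)^n}{\gamma}, & c<\gamma,\\[1ex] \gamma, & c\ge\gamma.\end{cases}$$ 3. For $n=2$, $\pi^*$ is optimal among all policies: no policy has a larger expected average reward. -/

import Mathlib

open MeasureTheory ProbabilityTheory Filter Topology Set
open scoped NNReal ENNReal

noncomputable section

namespace Channels

/-- The generator of a single channel: state `0` is bad, state `1` is good, the rate from bad to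
good is `1` and the rate from good to bad is `1/γ - 1`. -/
def generator (γ : ℝ) : Matrix (Fin 2) (Fin 2) ℝ :=
  !![-1, 1; 1 / γ - 1, -(1 / γ - 1)]

/-- The transition matrix `exp (t Q)` of a single channel over a time span `t`. -/
def transition (γ : ℝ) (t : ℝ≥0) : Matrix (Fin 2) (Fin 2) ℝ :=
  NormedSpace.exp ((t : ℝ) • generator γ)

/-- Right-continuous with left limits. -/
def IsCadlag {α : Type*} [TopologicalSpace α] (f : ℝ≥0 → α) : Prop :=
  (∀ t, ContinuousWithinAt f (Ici t) t) ∧ ∀ t, 0 < t → ∃ l, Tendsto f (𝓝[<] t) (𝓝 l)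

variable {Ω : Type*} {m : MeasurableSpace Ω} {n : ℕ}

/-- `X i t` is the state of channel `i` at time `t`. Relative to the information `ℱ` of the
controller, the channels evolve independently, each as a time-homogeneous Markov chain with
generator `generator γ`. The initial states are arbitrary. -/
structure IsChannelSystem (γ : ℝ) (μ : Measure Ω) (ℱ : Filtration ℝ≥0 m)
    (X : Fin n → ℝ≥0 → Ω → Fin 2) : Prop where
  /-- All channels are observed. -/
  adapted : ∀ i, Adapted ℱ (X i)
  cadlag : ∀ i ω, IsCadlag (fun t => X i t ω)
  /-- Given the information up to time `s`, the states at time `s + h` are independent, and that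
  of channel `i` has law `exp (h Q) (X i s, ·)`. -/
  markov : ∀ (s h : ℝ≥0) (y : Fin n → Fin 2),
    μ[Set.indicator {ω | ∀ i, X i (s + h) ω = y i} (fun _ => (1 : ℝ)) | ℱ s] =ᵐ[μ]
      fun ω => ∏ i, transition γ h (X i s ω) (y i)

/-- A control under full observation: `init` is the channel in use just before time `0`, and
`chan t` is the channel in use at time `t`. It depends only on the information up to time `t`;
it may be randomized, since `ℱ` may be larger than the filtration generated by the channels. -/
structure Control (n : ℕ) (ℱ : Filtration ℝ≥0 m) where
  init : Ω → Fin n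
  chan : ℝ≥0 → Ω → Fin n
  init_measurable : Measurable[ℱ 0] init
  adapted : Adapted ℱ chan
  cadlag : ∀ ω, IsCadlag (fun t => chan t ω)

namespace Control

variable {ℱ : Filtration ℝ≥0 m}

/-- The channel in use just before time `t`, that is, `U(t-)`. -/
def before (U : Control n ℱ) (t : ℝ≥0) (ω : Ω) : Fin n :=
  if t = 0 then U.init ω else Function.leftLim (fun s => U.chan s ω) t

/-- The number `N(t)` of channel changes during `[0,t]`. -/
def numSwitches (U : Control n ℱ) (t : ℝ≥0) (ω : Ω) : ℕ∞ :=
  Set.encard {s : ℝ≥0 | s ≤ t ∧ U.before s ω ≠ U.chan s ω}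

/-- The expected total reward `E ∫₀ᵗ X_{U(s)}(s) ds`. -/
def expectedReward (U : Control n ℱ) (μ : Measure Ω) (X : Fin n → ℝ≥0 → Ω → Fin 2)
    (t : ℝ≥0) : ℝ :=
  ∫ ω, ∫ s in (0 : ℝ)..t, ((X (U.chan s.toNNReal ω) s.toNNReal ω : ℕ) : ℝ) ∂volume ∂μ

/-- The expected number of channel changes during `[0,t]`, possibly infinite. -/
def expectedSwitches (U : Control n ℱ) (μ : Measure Ω) (t : ℝ≥0) : ℝ≥0∞ :=
  ∫⁻ ω, (U.numSwitches t ω : ℝ≥0∞) ∂μ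

/-- The long-run expected average reward with switching cost `c`. It is taken in the extended
reals, so that a control with infinitely many expected switches gets `-∞` when `c > 0`. -/
def avgReward (U : Control n ℱ) (μ : Measure Ω) (X : Fin n → ℝ≥0 → Ω → Fin 2) (c : ℝ) : EReal :=
  liminf (fun t : ℝ≥0 =>
    ((U.expectedReward μ X t : EReal) - (c : EReal) * (U.expectedSwitches μ t : EReal)) /
      ((t : ℝ) : EReal)) atTop

/-- `U` follows the policy `π^(s)`: never switch. -/
def NeverSwitches (U : Control n ℱ) : Prop :=
  ∀ t ω, U.chan t ω = U.before t ω

/-- `U` follows a policy `π^(a)`: when the current channel is bad and some channel is good, switch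
at once to a good channel, chosen arbitrarily; otherwise do not switch. -/
def AlwaysGood (U : Control n ℱ) (X : Fin n → ℝ≥0 → Ω → Fin 2) : Prop :=
  ∀ t ω,
    ((X (U.before t ω) t ω = 0 ∧ ∃ j, X j t ω = 1) → X (U.chan t ω) t ω = 1) ∧
    (¬ (X (U.before t ω) t ω = 0 ∧ ∃ j, X j t ω = 1) → U.chan t ω = U.before t ω)

/-- `U` follows `π^*`, which is `π^(a)` if `c < γ` and `π^(s)` if `c ≥ γ`. -/
def FollowsPiStar (U : Control n ℱ) (X : Fin n → ℝ≥0 → Ω → Fin 2) (γ c : ℝ) : Prop :=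
  (c < γ → U.AlwaysGood X) ∧ (γ ≤ c → U.NeverSwitches)

end Control

/-- The claimed expected average reward `g^*` of `π^*`. -/
def gStar (n : ℕ) (γ c : ℝ) : ℝ :=
  if c < γ then 1 - (1 - γ) ^ n - c * ((1 - γ - (1 - γ) ^ n) / γ) else γ

end Channels

end

open Channels

noncomputable section

namespace Channels

/-! ### Relaxation of a single channel and of the all-bad event. -/

section Transition

/-! Everything rests on two inequalities between the expected reward `R` and the expected number of
switches `N` on `[0,t]`, valid for every control.

First, a channel that is kept relaxes to its stationary mean `γ` at rate `1/γ`. The mean reward rate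
`r` thus changes by `-(r - γ)/γ` per unit time, plus whatever the switches contribute, and a switch
raises the state in use by at most 1. Integrating, `R ≤ γ t + γ N + γ`
(`expectedReward_le_switches`): reward above the stationary level must be bought at `γ` per switch.
Second, no choice earns anything while all channels are bad, an event of probability close to `(1 -
γ)^n`, so `R ≤ (1 - (1 - γ)^n) t + n γ` (`expectedReward_le`).

For `c ≥ γ` the first inequality bounds the average reward of every control by `γ`, which never
switching attains. For two channels and `c < γ`, the combination of the two with weights `c/γ` and
`1 - c/γ` gives exactly the claimed value. The policy `π^(a)` is asymptotically tight in both: it is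
good whenever some channel is, and each of its switches gains exactly 1, which fixes its switching
rate (`AlwaysGood.expectedSwitches_le` for the upper bound, the first inequality for the lower one).

The balance is made rigorous without stochastic calculus: `switchGain` collects the effect of
switches over a partition of `[0,t]`, its mean telescopes, and the mesh tends to zero. Existence of
`π^(a)` as an adapted càdlàg control is a separate matter, settled by approximation on time grids
(`exists_alwaysGood`). -/

theorem transition_eq {γ : ℝ} (hγ : γ ≠ 0) (h : ℝ≥0) :
    transition γ h =
      !![1 - γ + γ * Real.exp (-(h / γ)), γ - γ * Real.exp (-(h / γ));
        1 - γ - (1 - γ) * Real.exp (-(h / γ)), γ + (1 - γ) * Real.exp (-(h / γ))] := by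
  -- The columns are eigenvectors of the generator for the eigenvalues `0` and `-1/γ`.
  set S : Matrix (Fin 2) (Fin 2) ℝ := !![1, γ; 1, γ - 1] with hS
  have hdet : S.det = -1 := by simp [hS, Matrix.det_fin_two]
  have hunit : IsUnit S := by
    rw [Matrix.isUnit_iff_isUnit_det, hdet]
    simp
  have hinv : S⁻¹ = !![1 - γ, γ; 1, -1] := by
    apply Matrix.inv_eq_right_inv
    ext i j
    fin_cases i <;> fin_cases j <;> simp [hS, Matrix.mul_apply, Fin.sum_univ_two]
  have hdiag : ∀ a b : ℝ, Matrix.diagonal ![a, b] = !![a, 0; 0, b] := by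
    intro a b
    ext i j
    fin_cases i <;> fin_cases j <;> simp
  have hconj : (h : ℝ) • generator γ = S * Matrix.diagonal ![0, -((h : ℝ) / γ)] * S⁻¹ := by
    rw [hinv, hS, generator, hdiag]
    ext i j
    fin_cases i <;> fin_cases j <;> (simp [Matrix.mul_apply, Fin.sum_univ_two]; field_simp)
    ring
  have hexp : NormedSpace.exp ![(0 : ℝ), -((h : ℝ) / γ)] = ![1, Real.exp (-(h / γ))] := by
    rw [Pi.exp_def]
    ext i
    fin_cases i <;> simp [Real.exp_eq_exp_ℝ]
  rw [transition, hconj, Matrix.exp_conj _ _ hunit, Matrix.exp_diagonal, hexp, hinv, hS, hdiag]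
  ext i j
  fin_cases i <;> fin_cases j <;>
    simp [Matrix.mul_apply, Fin.sum_univ_two] <;> ring

theorem transition_one {γ : ℝ} (hγ : γ ≠ 0) (h : ℝ≥0) (x : Fin 2) :
    transition γ h x 1 = γ + (((x : ℕ) : ℝ) - γ) * Real.exp (-(h / γ)) := by
  rw [transition_eq hγ]
  fin_cases x
  · simp
    ring
  · simp

theorem transition_zero {γ : ℝ} (hγ : γ ≠ 0) (h : ℝ≥0) (x : Fin 2) :
    transition γ h x 0 = 1 - γ - (((x : ℕ) : ℝ) - γ) * Real.exp (-(h / γ)) := by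
  rw [transition_eq hγ]
  fin_cases x <;> simp

variable {Ω : Type*} {m : MeasurableSpace Ω} {n : ℕ} {γ : ℝ} {μ : Measure Ω}
  {ℱ : Filtration ℝ≥0 m} {X : Fin n → ℝ≥0 → Ω → Fin 2}

/-- Marginalisation: the sum factorises over channels, and the factors with `j ≠ i` are row sums of
a stochastic matrix, hence 1. -/
theorem sum_val_mul_prod_transition (hγ : γ ≠ 0) (h : ℝ≥0) (x : Fin n → Fin 2) (i : Fin n) :
    ∑ y : Fin n → Fin 2, ((y i : ℕ) : ℝ) * ∏ j, transition γ h (x j) (y j) =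
      transition γ h (x i) 1 := by
  have key := Finset.prod_univ_sum (fun _ : Fin n => (Finset.univ : Finset (Fin 2)))
    (fun j b => transition γ h (x j) b * if j = i then ((b : ℕ) : ℝ) else 1)
  rw [Fintype.piFinset_univ] at key
  have hl : ∏ j, ∑ b, transition γ h (x j) b * (if j = i then ((b : ℕ) : ℝ) else 1) =
      transition γ h (x i) 1 := by
    rw [Finset.prod_eq_single i]
    · simp
    · intro j _ hj
      simp [hj, transition_one hγ, transition_zero hγ]
    · simp
  rw [← hl, key]
  refine Finset.sum_congr rfl fun y _ => ?_
  rw [Finset.prod_mul_distrib, Finset.prod_ite_eq']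
  simp [mul_comm]

theorem val_le_one (x : Fin 2) : ((x : ℕ) : ℝ) ≤ 1 := by
  exact_mod_cast Nat.lt_succ_iff.mp x.isLt

theorem abs_val_le_one (x : Fin 2) : |((x : ℕ) : ℝ)| ≤ 1 := by
  rw [abs_of_nonneg (Nat.cast_nonneg _)]
  exact val_le_one x

theorem val_eq_ite (x : Fin 2) : ((x : ℕ) : ℝ) = if x = 1 then 1 else 0 := by
  fin_cases x <;> simp

theorem IsChannelSystem.measurable (hX : IsChannelSystem γ μ ℱ X) (i : Fin n) (s : ℝ≥0) :
    Measurable (X i s) :=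
  (hX.adapted i s).mono (ℱ.le s) le_rfl

theorem IsChannelSystem.measurableSet_states (hX : IsChannelSystem γ μ ℱ X) (s : ℝ≥0)
    (y : Fin n → Fin 2) : MeasurableSet {ω | ∀ i, X i s ω = y i} := by
  rw [Set.ofPred_forall]
  exact MeasurableSet.iInter fun i => hX.measurable i s (measurableSet_singleton _)

theorem measurable_select {m' : MeasurableSpace Ω} {u : Ω → Fin n} (hu : Measurable[m'] u)
    {Y : Fin n → Ω → Fin 2} (hY : ∀ i, Measurable[m'] (Y i)) :
    Measurable[m'] (fun ω => Y (u ω) ω) := by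
  have h : Measurable[m'] (fun ω => (u ω, fun i => Y i ω)) :=
    hu.prodMk (measurable_pi_lambda _ hY)
  exact (measurable_of_countable (fun p : Fin n × (Fin n → Fin 2) => p.2 p.1)).comp h

theorem measurable_val : Measurable (fun x : Fin 2 => ((x : ℕ) : ℝ)) :=
  measurable_of_countable _

theorem integrable_val [IsFiniteMeasure μ] {Y : Ω → Fin 2} (hY : Measurable Y) :
    Integrable (fun ω => ((Y ω : ℕ) : ℝ)) μ :=
  Integrable.of_bound (measurable_val.comp hY).aestronglyMeasurable 1
    (Eventually.of_forall fun ω => abs_val_le_one (Y ω))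

theorem IsChannelSystem.setIntegral_indicator [IsProbabilityMeasure μ]
    (hX : IsChannelSystem γ μ ℱ X) (s h : ℝ≥0) (y : Fin n → Fin 2) {A : Set Ω}
    (hA : MeasurableSet[ℱ s] A) :
    ∫ ω in A, Set.indicator {ω | ∀ i, X i (s + h) ω = y i} (fun _ => (1 : ℝ)) ω ∂μ =
      ∫ ω in A, ∏ i, transition γ h (X i s ω) (y i) ∂μ := by
  rw [← setIntegral_condExp (ℱ.le s)
    ((integrable_const (1 : ℝ)).indicator (hX.measurableSet_states _ _)) hA]
  exact setIntegral_congr_ae (ℱ.le s _ hA) ((hX.markov s h y).mono fun ω hω _ => hω)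

theorem integrable_comp_channels [IsFiniteMeasure μ] (hX : IsChannelSystem γ μ ℱ X) (s : ℝ≥0)
    (φ : (Fin n → Fin 2) → ℝ) : Integrable (fun ω => φ (fun i => X i s ω)) μ := by
  refine Integrable.of_bound ((measurable_of_countable φ).comp
    (measurable_pi_lambda _ fun i => hX.measurable i s)).aestronglyMeasurable
    (∑ y, ‖φ y‖) (Eventually.of_forall fun ω => ?_)
  exact Finset.single_le_sum (f := fun y => ‖φ y‖) (fun _ _ => norm_nonneg _) (Finset.mem_univ _)

theorem IsChannelSystem.setIntegral_channel [IsProbabilityMeasure μ]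
    (hX : IsChannelSystem γ μ ℱ X) (hγ : γ ≠ 0) (s h : ℝ≥0) (i : Fin n) {A : Set Ω}
    (hA : MeasurableSet[ℱ s] A) :
    ∫ ω in A, ((X i (s + h) ω : ℕ) : ℝ) ∂μ = ∫ ω in A, transition γ h (X i s ω) 1 ∂μ := by
  have h1 : ∀ ω, ((X i (s + h) ω : ℕ) : ℝ) = ∑ y : Fin n → Fin 2, ((y i : ℕ) : ℝ) *
      Set.indicator {ω | ∀ i, X i (s + h) ω = y i} (fun _ => (1 : ℝ)) ω := by
    intro ω
    rw [Finset.sum_eq_single (fun j => X j (s + h) ω)]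
    · simp
    · intro y _ hy
      rw [Set.indicator_of_notMem, mul_zero]
      exact fun hmem => hy (funext fun j => (hmem j).symm)
    · simp
  have h2 : ∀ ω, transition γ h (X i s ω) 1 = ∑ y : Fin n → Fin 2, ((y i : ℕ) : ℝ) *
      ∏ j, transition γ h (X j s ω) (y j) := fun ω =>
    (sum_val_mul_prod_transition hγ h (fun j => X j s ω) i).symm
  simp_rw [h1, h2]
  rw [integral_finsetSum, integral_finsetSum]
  · refine Finset.sum_congr rfl fun y _ => ?_
    rw [integral_const_mul, integral_const_mul, hX.setIntegral_indicator s h y hA]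
  · intro y _
    exact (integrable_comp_channels hX s (fun x => ((y i : ℕ) : ℝ) *
      ∏ j, transition γ h (x j) (y j))).integrableOn
  · intro y _
    exact (Integrable.const_mul ((integrable_const (1 : ℝ)).indicator
      (hX.measurableSet_states _ _)) _).integrableOn

/-- The probability that the channel selected by `u` is good at time `s`. -/
def meanState (μ : Measure Ω) (X : Fin n → ℝ≥0 → Ω → Fin 2) (u : Ω → Fin n) (s : ℝ≥0) : ℝ :=
  ∫ ω, ((X (u ω) s ω : ℕ) : ℝ) ∂μ

/-- The probability that all channels are bad at time `s`. -/
def probAllBad (μ : Measure Ω) (X : Fin n → ℝ≥0 → Ω → Fin 2) (s : ℝ≥0) : ℝ :=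
  ∫ ω, Set.indicator {ω | ∀ i, X i s ω = 0} (fun _ => (1 : ℝ)) ω ∂μ

theorem integrable_select [IsFiniteMeasure μ] (hX : IsChannelSystem γ μ ℱ X) {u : Ω → Fin n}
    (hu : Measurable u) (s : ℝ≥0) : Integrable (fun ω => ((X (u ω) s ω : ℕ) : ℝ)) μ :=
  integrable_val (measurable_select hu fun i => hX.measurable i s)

/-- Reduces a randomly selected channel to fixed ones. When `u` is known at time `s`, its fibres lie
in `ℱ s`, so the Markov property can be integrated over each. -/
theorem integral_eq_sum_fiber [IsFiniteMeasure μ] {u : Ω → Fin n} (hu : Measurable u)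
    {f : Fin n → Ω → ℝ} (hf : ∀ i, Integrable (f i) μ) :
    ∫ ω, f (u ω) ω ∂μ = ∑ i, ∫ ω in u ⁻¹' {i}, f i ω ∂μ := by
  have h1 : ∀ ω, f (u ω) ω = ∑ i, Set.indicator (u ⁻¹' {i}) (f i) ω := by
    intro ω
    rw [Finset.sum_eq_single (u ω)]
    · simp
    · intro i _ hi
      exact Set.indicator_of_notMem (fun hmem => hi (by simpa using hmem.symm)) _
    · simp
  simp_rw [h1]
  rw [integral_finsetSum]
  · exact Finset.sum_congr rfl fun i _ => integral_indicator (hu (measurableSet_singleton i))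
  · exact fun i _ => (hf i).indicator (hu (measurableSet_singleton i))

/-- The state of a channel chosen at time `s` relaxes exponentially to the stationary one. -/
theorem IsChannelSystem.meanState_add [IsProbabilityMeasure μ] (hX : IsChannelSystem γ μ ℱ X)
    (hγ : γ ≠ 0) (s h : ℝ≥0) {u : Ω → Fin n} (hu : Measurable[ℱ s] u) :
    meanState μ X u (s + h) = γ + (meanState μ X u s - γ) * Real.exp (-(h / γ)) := by
  have hu' : Measurable u := hu.mono (ℱ.le s) le_rfl
  have h1 : meanState μ X u (s + h) = ∫ ω, transition γ h (X (u ω) s ω) 1 ∂μ := by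
    rw [meanState, integral_eq_sum_fiber (f := fun i ω => ((X i (s + h) ω : ℕ) : ℝ)) hu'
        (fun i => integrable_val (hX.measurable i _)),
      integral_eq_sum_fiber (f := fun i ω => transition γ h (X i s ω) 1) hu'
        (fun i => integrable_comp_channels hX s (fun x => transition γ h (x i) 1))]
    exact Finset.sum_congr rfl fun i _ =>
      hX.setIntegral_channel hγ s h i (hu (measurableSet_singleton i))
  have hi := integrable_select hX hu' s
  rw [h1, meanState]
  simp_rw [transition_one hγ]
  have hd : Integrable (fun ω => ((X (u ω) s ω : ℕ) : ℝ) - γ) μ := hi.sub (integrable_const _)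
  rw [integral_add (integrable_const _) (hd.mul_const _),
    integral_mul_const, integral_sub hi (integrable_const _)]
  simp

theorem abs_prod_sub_prod_le {ι : Type*} (s : Finset ι) (a b : ι → ℝ) (δ : ℝ)
    (ha : ∀ i ∈ s, |a i| ≤ 1) (hb : ∀ i ∈ s, |b i| ≤ 1) (hab : ∀ i ∈ s, |a i - b i| ≤ δ) :
    |∏ i ∈ s, a i - ∏ i ∈ s, b i| ≤ s.card * δ := by
  classical
  induction s using Finset.induction_on with
  | empty => simp
  | insert i s hi ih =>
    simp only [Finset.mem_insert, forall_eq_or_imp] at ha hb hab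
    have h1 := ih ha.2 hb.2 hab.2
    have h2 : |∏ j ∈ s, b j| ≤ 1 := by
      rw [Finset.abs_prod]
      exact Finset.prod_le_one (fun _ _ => abs_nonneg _) hb.2
    rw [Finset.prod_insert hi, Finset.prod_insert hi, Finset.card_insert_of_notMem hi]
    have h3 : a i * ∏ j ∈ s, a j - b i * ∏ j ∈ s, b j =
        a i * (∏ j ∈ s, a j - ∏ j ∈ s, b j) + (a i - b i) * ∏ j ∈ s, b j := by ring
    rw [h3]
    refine (abs_add_le _ _).trans ?_
    rw [abs_mul, abs_mul]
    have h4 := mul_le_mul ha.1 h1 (abs_nonneg _) zero_le_one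
    have h5 := mul_le_mul hab.1 h2 (abs_nonneg _) ((abs_nonneg _).trans hab.1)
    push_cast
    linarith

/-- The probability that all channels are bad converges exponentially to `(1 - γ) ^ n`. -/
theorem IsChannelSystem.abs_probAllBad_sub_le [IsProbabilityMeasure μ]
    (hX : IsChannelSystem γ μ ℱ X) (hγ0 : 0 < γ) (hγ1 : γ < 1) (s : ℝ≥0) :
    |probAllBad μ X s - (1 - γ) ^ n| ≤ n * Real.exp (-(s / γ)) := by
  have h0 := hX.setIntegral_indicator 0 s (fun _ => 0) MeasurableSet.univ
  simp only [Measure.restrict_univ, zero_add] at h0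
  have hint := integrable_comp_channels hX 0 (fun x => ∏ i, transition γ s (x i) 0)
  have he1 : Real.exp (-(s / γ)) ≤ 1 := by
    rw [Real.exp_le_one_iff]
    exact neg_nonpos.mpr (by positivity)
  have he0 := Real.exp_pos (-(s / γ))
  have h1 : probAllBad μ X s - (1 - γ) ^ n =
      ∫ ω, (∏ i, transition γ s (X i 0 ω) 0 - ∏ _i : Fin n, (1 - γ)) ∂μ := by
    rw [integral_sub hint (integrable_const _), probAllBad, h0]
    simp
  rw [h1]
  rw [← Real.norm_eq_abs]
  suffices h : ∀ ω, ‖∏ i, transition γ s (X i 0 ω) 0 - ∏ _i : Fin n, (1 - γ)‖ ≤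
      n * Real.exp (-(s / γ)) by
    have h2 := norm_integral_le_of_norm_le_const (μ := μ) (Eventually.of_forall h)
    rwa [probReal_univ, mul_one] at h2
  intro ω
  have h2 := abs_prod_sub_prod_le Finset.univ (fun i => transition γ s (X i 0 ω) 0)
    (fun _ => 1 - γ) (Real.exp (-(s / γ))) ?_ ?_ ?_
  · simpa using h2
  all_goals intro i _
  · simp only [transition_zero hγ0.ne', val_eq_ite]
    rw [abs_le]
    split_ifs <;> constructor <;> nlinarith
  · rw [abs_le]
    constructor <;> linarith
  · simp only [transition_zero hγ0.ne', val_eq_ite]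
    rw [abs_le]
    split_ifs <;> constructor <;> nlinarith

theorem IsChannelSystem.abs_meanState_sub_le [IsProbabilityMeasure μ]
    (hX : IsChannelSystem γ μ ℱ X) (hγ0 : 0 < γ) (hγ1 : γ < 1) (s : ℝ≥0) {u : Ω → Fin n}
    (hu : Measurable[ℱ 0] u) : |meanState μ X u s - γ| ≤ Real.exp (-(s / γ)) := by
  have h1 := hX.meanState_add hγ0.ne' 0 s hu
  rw [zero_add] at h1
  have hi := integrable_select hX (hu.mono (ℱ.le 0) le_rfl) 0
  have h2 : 0 ≤ meanState μ X u 0 := integral_nonneg fun ω => Nat.cast_nonneg _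
  have h3 : meanState μ X u 0 ≤ 1 := by
    refine (integral_mono hi (integrable_const (1 : ℝ)) fun ω => val_le_one _).trans ?_
    simp
  rw [h1, add_sub_cancel_left, abs_mul, abs_of_pos (Real.exp_pos _)]
  refine mul_le_of_le_one_left (Real.exp_pos _).le ?_
  rw [abs_le]
  constructor <;> linarith

/-- On the all-bad event every selection yields 0, and elsewhere at most 1. `meanState_eq` is the
case in which 1 is attained off that event. -/
theorem meanState_le [IsProbabilityMeasure μ] (hX : IsChannelSystem γ μ ℱ X) {u : Ω → Fin n}
    (hu : Measurable u) (s : ℝ≥0) : meanState μ X u s ≤ 1 - probAllBad μ X s := by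
  have hi := integrable_select hX hu s
  have hb : Integrable (Set.indicator {ω | ∀ i, X i s ω = 0} (fun _ => (1 : ℝ))) μ :=
    (integrable_const (1 : ℝ)).indicator (hX.measurableSet_states s _)
  have h1 : 1 - probAllBad μ X s =
      ∫ ω, (1 - Set.indicator {ω | ∀ i, X i s ω = 0} (fun _ => (1 : ℝ)) ω) ∂μ := by
    rw [integral_sub (integrable_const _) hb, probAllBad]
    simp
  rw [h1]
  refine integral_mono hi ((integrable_const _).sub hb) fun ω => ?_
  by_cases h : ∀ i, X i s ω = 0
  · simp [h]
  · simpa [h] using val_le_one _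

theorem meanState_eq [IsProbabilityMeasure μ] (hX : IsChannelSystem γ μ ℱ X) {u : Ω → Fin n}
    {s : ℝ≥0} (hgood : ∀ ω, (∃ i, X i s ω = 1) → X (u ω) s ω = 1) :
    meanState μ X u s = 1 - probAllBad μ X s := by
  have hb : Integrable (Set.indicator {ω | ∀ i, X i s ω = 0} (fun _ => (1 : ℝ))) μ :=
    (integrable_const (1 : ℝ)).indicator (hX.measurableSet_states s _)
  have h1 : 1 - probAllBad μ X s =
      ∫ ω, (1 - Set.indicator {ω | ∀ i, X i s ω = 0} (fun _ => (1 : ℝ)) ω) ∂μ := by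
    rw [integral_sub (integrable_const _) hb, probAllBad]
    simp
  rw [h1]
  refine integral_congr_ae (Eventually.of_forall fun ω => ?_)
  by_cases h : ∀ i, X i s ω = 0
  · simp [h]
  · have h' : ∃ i, X i s ω = 1 := by
      by_contra hne
      push Not at hne
      exact h fun i => by have := hne i; omega
    simp [h, hgood ω h']

end Transition

/-! ### Reward and switches along partitions of the time interval. -/

section Discretization

variable {Ω : Type*} {m : MeasurableSpace Ω} {n : ℕ} {γ : ℝ} {μ : Measure Ω}
  {ℱ : Filtration ℝ≥0 m} {X : Fin n → ℝ≥0 → Ω → Fin 2}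

/-- The width of the partition of `[0,t]` into `K + 1` intervals of equal length. -/
def mesh (t : ℝ≥0) (K : ℕ) : ℝ≥0 := t / (K + 1)

theorem mesh_pos {t : ℝ≥0} (ht : 0 < t) (K : ℕ) : 0 < mesh t K :=
  div_pos ht (by positivity)

theorem succ_mul_mesh (t : ℝ≥0) (K : ℕ) : (K + 1) * mesh t K = t :=
  mul_div_cancel₀ t (by positivity)

theorem coe_succ_mul_mesh (t : ℝ≥0) (K : ℕ) : ((K : ℝ) + 1) * (mesh t K : ℝ) = t := by
  exact_mod_cast congrArg ((↑) : ℝ≥0 → ℝ) (succ_mul_mesh t K)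

theorem tendsto_mesh (t : ℝ≥0) : Tendsto (mesh t) atTop (𝓝 0) := by
  have h := (tendsto_const_div_atTop_nhds_zero_nat (𝕜 := ℝ) (t : ℝ)).comp (tendsto_add_atTop_nat 1)
  rw [← NNReal.tendsto_coe]
  refine h.congr fun K => ?_
  simp [mesh]

/-- Right endpoints approach each point from the right, where `g` is locally constant, so the step
functions are eventually equal to `g` pointwise and dominated convergence applies. No measurability
of `g` has to be assumed. -/
theorem tendsto_riemannSum {g : ℝ≥0 → ℝ} (hg : ∀ s, |g s| ≤ 1)
    (hright : ∀ t, ∀ᶠ s in 𝓝[≥] t, g s = g t) {t : ℝ≥0} (ht : 0 < t) :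
    Tendsto (fun K : ℕ => (mesh t K : ℝ) *
      ∑ j ∈ Finset.range (K + 1), g ((j + 1 : ℕ) * mesh t K)) atTop
      (𝓝 (∫ s in (0 : ℝ)..t, g s.toNNReal)) := by
  set F : ℕ → ℝ → ℝ := fun K s => g (⌈s / mesh t K⌉₊ * mesh t K) with hF
  have hmeas : ∀ K, Measurable (F K) := fun K =>
    (measurable_of_countable (fun j : ℕ => g (j * mesh t K))).comp
      (Nat.measurable_ceil.comp (measurable_id.div_const _))
  have hbound : ∀ K s, ‖F K s‖ ≤ 1 := fun K s => hg _
  have hint : ∀ K a b, IntervalIntegrable (F K) volume a b := fun K a b =>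
    (intervalIntegrable_const (c := (1 : ℝ))).mono_fun (hmeas K).aestronglyMeasurable
      (Eventually.of_forall fun s => by simpa using hbound K s)
  have hsum : ∀ K : ℕ, (mesh t K : ℝ) * ∑ j ∈ Finset.range (K + 1), g ((j + 1 : ℕ) * mesh t K) =
      ∫ s in (0 : ℝ)..t, F K s := by
    intro K
    have hpos : (0 : ℝ) < mesh t K := mesh_pos ht K
    have hadj := intervalIntegral.sum_integral_adjacent_intervals
      (f := F K) (μ := volume) (a := fun j : ℕ => (j : ℝ) * mesh t K) (n := K + 1)
      (fun j _ => hint K _ _)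
    simp only [Nat.cast_zero, zero_mul] at hadj
    have hend : ((K + 1 : ℕ) : ℝ) * mesh t K = t := by
      push_cast
      exact coe_succ_mul_mesh t K
    rw [hend] at hadj
    rw [← hadj, Finset.mul_sum]
    refine Finset.sum_congr rfl fun j _ => ?_
    have hle : (j : ℝ) * mesh t K ≤ ((j + 1 : ℕ) : ℝ) * mesh t K := by
      push_cast
      nlinarith
    have hc : ∫ s in ((j : ℝ) * mesh t K)..(((j + 1 : ℕ) : ℝ) * mesh t K), F K s =
        ∫ _s in ((j : ℝ) * mesh t K)..(((j + 1 : ℕ) : ℝ) * mesh t K),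
          g ((j + 1 : ℕ) * mesh t K) := by
      rw [intervalIntegral.integral_of_le hle, intervalIntegral.integral_of_le hle]
      refine setIntegral_congr_fun measurableSet_Ioc fun s hs => ?_
      have hceil : ⌈s / mesh t K⌉₊ = j + 1 := by
        rw [Nat.ceil_eq_iff (Nat.succ_ne_zero j)]
        constructor
        · rw [lt_div_iff₀ hpos]
          simpa using hs.1
        · rw [div_le_iff₀ hpos]
          exact hs.2
      simp only [hF, hceil]
    rw [hc, intervalIntegral.integral_const, smul_eq_mul]
    push_cast
    ring
  simp_rw [hsum]
  refine intervalIntegral.tendsto_integral_filter_of_dominated_convergence (fun _ => (1 : ℝ))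
    (Eventually.of_forall fun K => (hmeas K).aestronglyMeasurable)
    (Eventually.of_forall fun K => Eventually.of_forall fun s _ => hbound K s)
    intervalIntegrable_const (Eventually.of_forall fun s hs => ?_)
  rw [uIoc_of_le t.coe_nonneg] at hs
  have hle : ∀ K, s.toNNReal ≤ ⌈s / mesh t K⌉₊ * mesh t K := by
    intro K
    have hpos : (0 : ℝ) < mesh t K := mesh_pos ht K
    rw [Real.toNNReal_le_iff_le_coe]
    push_cast
    rw [← div_le_iff₀ hpos]
    exact Nat.le_ceil _
  have hupper : ∀ K, (⌈s / mesh t K⌉₊ : ℝ≥0) * mesh t K ≤ s.toNNReal + mesh t K := by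
    intro K
    have hpos : (0 : ℝ) < mesh t K := mesh_pos ht K
    rw [← NNReal.coe_le_coe]
    push_cast
    rw [Real.coe_toNNReal _ hs.1.le]
    have h1 := Nat.ceil_lt_add_one (div_nonneg hs.1.le hpos.le)
    have h2 := mul_lt_mul_of_pos_right h1 hpos
    rw [add_mul, div_mul_cancel₀ _ hpos.ne', one_mul] at h2
    exact h2.le
  have hlim : Tendsto (fun K => (⌈s / mesh t K⌉₊ : ℝ≥0) * mesh t K) atTop (𝓝 s.toNNReal) := by
    refine tendsto_of_tendsto_of_tendsto_of_le_of_le tendsto_const_nhds ?_ hle hupper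
    simpa using (tendsto_const_nhds (x := s.toNNReal)).add (tendsto_mesh t)
  have hlim' : Tendsto (fun K => (⌈s / mesh t K⌉₊ : ℝ≥0) * mesh t K) atTop (𝓝[≥] s.toNNReal) :=
    tendsto_nhdsWithin_iff.mpr ⟨hlim, Eventually.of_forall hle⟩
  exact tendsto_const_nhds.congr' ((hlim'.eventually (hright _)).mono fun K hK => hK.symm)

theorem IsCadlag.eventually_right {α : Type*} [TopologicalSpace α] [DiscreteTopology α]
    {f : ℝ≥0 → α} (hf : IsCadlag f) (t : ℝ≥0) : ∀ᶠ s in 𝓝[≥] t, f s = f t := by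
  have h := hf.1 t
  rw [ContinuousWithinAt, nhds_discrete, tendsto_pure] at h
  exact h

theorem IsCadlag.eventually_left {α : Type*} [TopologicalSpace α] [DiscreteTopology α]
    {f : ℝ≥0 → α} (hf : IsCadlag f) {t : ℝ≥0} (ht : 0 < t) :
    ∃ l, ∀ᶠ s in 𝓝[<] t, f s = l := by
  obtain ⟨l, hl⟩ := hf.2 t ht
  rw [nhds_discrete, tendsto_pure] at hl
  exact ⟨l, hl⟩

theorem nhdsLT_neBot {t : ℝ≥0} (ht : 0 < t) : (𝓝[<] t).NeBot :=
  nhdsLT_neBot_of_exists_lt ⟨0, ht⟩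

namespace Control

theorem measurable_chan (U : Control n ℱ) (t : ℝ≥0) : Measurable (U.chan t) :=
  (U.adapted t).mono (ℱ.le t) le_rfl

theorem before_zero (U : Control n ℱ) (ω : Ω) : U.before 0 ω = U.init ω := by
  simp [before]

theorem before_eq_of_eventually (U : Control n ℱ) {t : ℝ≥0} (ht : 0 < t) {ω : Ω} {v : Fin n}
    (h : ∀ᶠ s in 𝓝[<] t, U.chan s ω = v) : U.before t ω = v := by
  have := nhdsLT_neBot ht
  rw [before, if_neg ht.ne']
  refine leftLim_eq_of_tendsto ?_
  rw [nhds_discrete, tendsto_pure]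
  exact h

theorem eventually_before (U : Control n ℱ) {t : ℝ≥0} (ht : 0 < t) (ω : Ω) :
    ∀ᶠ s in 𝓝[<] t, U.chan s ω = U.before t ω := by
  obtain ⟨l, hl⟩ := (U.cadlag ω).eventually_left ht
  rwa [U.before_eq_of_eventually ht hl]

/-- Without a switch in `(a, b]` the path would be continuous into a discrete space on a connected
interval, hence constant. -/
theorem exists_switch (U : Control n ℱ) {a b : ℝ≥0} (hab : a ≤ b) {ω : Ω}
    (hne : U.chan a ω ≠ U.chan b ω) : ∃ s, a < s ∧ s ≤ b ∧ U.before s ω ≠ U.chan s ω := by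
  by_contra hcon
  push Not at hcon
  refine hne (isPreconnected_Icc.constant (s := Icc a b) (f := fun s => U.chan s ω) ?_
    (left_mem_Icc.mpr hab) (right_mem_Icc.mpr hab))
  intro s hs
  rw [ContinuousWithinAt, nhds_discrete, tendsto_pure]
  have hr := (U.cadlag ω).eventually_right s
  rcases hs.1.eq_or_lt with rfl | hlt
  · exact hr.filter_mono (nhdsWithin_mono _ Icc_subset_Ici_self)
  · have hl := U.eventually_before (bot_le.trans_lt hlt) ω
    rw [hcon s hlt hs.2] at hl
    refine Eventually.filter_mono nhdsWithin_le_nhds ?_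
    rw [← nhdsLT_sup_nhdsGE, eventually_sup]
    exact ⟨hl, hr⟩

/-- A cell whose end nodes carry different channels contains a switch; the half-open cells are
disjoint, so these switches are distinct. -/
theorem card_changes_le_numSwitches (U : Control n ℱ) (t : ℝ≥0) (K : ℕ) (ω : Ω) :
    (((Finset.range (K + 1)).filter fun j : ℕ =>
      U.chan (j * mesh t K) ω ≠ U.chan ((j + 1 : ℕ) * mesh t K) ω).card : ℕ∞) ≤
      U.numSwitches t ω := by
  have hstep : ∀ i j : ℕ, i ≤ j → (i : ℝ≥0) * mesh t K ≤ j * mesh t K := fun i j hij => by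
    gcongr
  have hex : ∀ j : ℕ, ∃ s, U.chan (j * mesh t K) ω ≠ U.chan ((j + 1 : ℕ) * mesh t K) ω →
      j * mesh t K < s ∧ s ≤ (j + 1 : ℕ) * mesh t K ∧ U.before s ω ≠ U.chan s ω := by
    intro j
    by_cases h : U.chan (j * mesh t K) ω ≠ U.chan ((j + 1 : ℕ) * mesh t K) ω
    · obtain ⟨s, hs⟩ := U.exists_switch (hstep j (j + 1) (Nat.le_succ j)) h
      exact ⟨s, fun _ => hs⟩
    · exact ⟨0, fun h' => absurd h' h⟩
  choose σ hσ using hex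
  rw [← Set.encard_coe_eq_coe_finsetCard, numSwitches]
  refine Set.encard_le_encard_of_injOn (f := σ) ?_ ?_
  · intro j hj
    simp only [Finset.coe_filter, Finset.mem_range, mem_ofPred_eq] at hj
    obtain ⟨_, h2, h3⟩ := hσ j hj.2
    refine ⟨h2.trans ?_, h3⟩
    have h4 := hstep (j + 1) (K + 1) hj.1
    rwa [Nat.cast_succ K, succ_mul_mesh] at h4
  · intro i hi j hj hij
    simp only [Finset.coe_filter, Finset.mem_range, mem_ofPred_eq] at hi hj
    obtain ⟨hi1, hi2, _⟩ := hσ i hi.2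
    obtain ⟨hj1, hj2, _⟩ := hσ j hj.2
    rcases lt_trichotomy i j with h | h | h
    · exact absurd (hij ▸ hi2.trans (hstep _ _ h)) (not_le.mpr hj1)
    · exact h
    · exact absurd (hij ▸ hj2.trans (hstep _ _ h)) (not_le.mpr (hij ▸ hi1))

/-- The gain in the state of the channel in use that is due to the channel changes between the
nodes of a partition of `[0,t]`. -/
def switchGain (U : Control n ℱ) (X : Fin n → ℝ≥0 → Ω → Fin 2) (t : ℝ≥0) (K : ℕ) (ω : Ω) : ℝ :=
  ∑ j ∈ Finset.range (K + 1),
    (((X (U.chan ((j + 1 : ℕ) * mesh t K) ω) ((j + 1 : ℕ) * mesh t K) ω : ℕ) : ℝ) -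
      ((X (U.chan (j * mesh t K) ω) ((j + 1 : ℕ) * mesh t K) ω : ℕ) : ℝ))

/-- A term is at most 1, and it vanishes if the channel is the same at both nodes. -/
theorem switchGain_le (U : Control n ℱ) (X : Fin n → ℝ≥0 → Ω → Fin 2) (t : ℝ≥0) (K : ℕ) (ω : Ω) :
    ENNReal.ofReal (U.switchGain X t K ω) ≤ (U.numSwitches t ω : ℝ≥0∞) := by
  have h1 := U.card_changes_le_numSwitches t K ω
  rw [← ENat.toENNReal_le, ENat.toENNReal_coe] at h1
  refine le_trans ?_ h1
  rw [← ENNReal.ofReal_natCast]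
  refine ENNReal.ofReal_le_ofReal ?_
  rw [Finset.card_filter, switchGain]
  push_cast
  refine Finset.sum_le_sum fun j _ => ?_
  split_ifs with h
  · linarith [val_le_one (X (U.chan (((j : ℝ≥0) + 1) * mesh t K) ω) (((j : ℝ≥0) + 1) * mesh t K) ω),
      Nat.cast_nonneg (α := ℝ) ((X (U.chan (j * mesh t K) ω) (((j : ℝ≥0) + 1) * mesh t K) ω : ℕ))]
  · push Not at h
    rw [h, sub_self]

/-- The expected reward rate at time `s`. -/
def rate (U : Control n ℱ) (μ : Measure Ω) (X : Fin n → ℝ≥0 → Ω → Fin 2) (s : ℝ≥0) : ℝ :=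
  meanState μ X (U.chan s) s

theorem tendsto_expectedReward [IsProbabilityMeasure μ] (hX : IsChannelSystem γ μ ℱ X)
    (U : Control n ℱ) {t : ℝ≥0} (ht : 0 < t) :
    Tendsto (fun K : ℕ => (mesh t K : ℝ) *
      ∑ j ∈ Finset.range (K + 1), U.rate μ X ((j + 1 : ℕ) * mesh t K)) atTop
      (𝓝 (U.expectedReward μ X t)) := by
  have hpath : ∀ ω, Tendsto (fun K : ℕ => (mesh t K : ℝ) * ∑ j ∈ Finset.range (K + 1),
      ((X (U.chan ((j + 1 : ℕ) * mesh t K) ω) ((j + 1 : ℕ) * mesh t K) ω : ℕ) : ℝ)) atTop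
      (𝓝 (∫ s in (0 : ℝ)..t, ((X (U.chan s.toNNReal ω) s.toNNReal ω : ℕ) : ℝ))) := by
    intro ω
    refine tendsto_riemannSum (g := fun s => ((X (U.chan s ω) s ω : ℕ) : ℝ))
      (fun s => abs_val_le_one _) (fun s => ?_) ht
    have h1 : ∀ᶠ r in 𝓝[≥] s, ∀ i, X i r ω = X i s ω :=
      eventually_all.mpr fun i => (hX.cadlag i ω).eventually_right s
    filter_upwards [h1, (U.cadlag ω).eventually_right s] with r hr hr'
    rw [hr', hr]
  have hint : ∀ s, Integrable (fun ω => ((X (U.chan s ω) s ω : ℕ) : ℝ)) μ := fun s =>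
    integrable_select hX (U.measurable_chan s) s
  have hlim := tendsto_integral_of_dominated_convergence (μ := μ) (fun _ => (t : ℝ))
    (F := fun (K : ℕ) ω => (mesh t K : ℝ) * ∑ j ∈ Finset.range (K + 1),
      ((X (U.chan ((j + 1 : ℕ) * mesh t K) ω) ((j + 1 : ℕ) * mesh t K) ω : ℕ) : ℝ))
    (fun K => ((integrable_finsetSum _ fun j _ => hint _).const_mul _).aestronglyMeasurable)
    (integrable_const _) (fun K => Eventually.of_forall fun ω => ?_)
    (Eventually.of_forall hpath)
  · refine hlim.congr fun K => ?_
    rw [integral_const_mul, integral_finsetSum _ fun j _ => hint _]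
    rfl
  · rw [Real.norm_eq_abs, abs_mul, abs_of_nonneg (NNReal.coe_nonneg _), ← coe_succ_mul_mesh t K,
      mul_comm]
    refine mul_le_mul_of_nonneg_right ?_ (NNReal.coe_nonneg _)
    refine (Finset.abs_sum_le_sum_abs _ _).trans
      ((Finset.sum_le_sum fun j _ => abs_val_le_one _).trans ?_)
    simp

theorem AlwaysGood.state_eq_one {U : Control n ℱ} (hU : U.AlwaysGood X) {t : ℝ≥0} {ω : Ω}
    (h : ∃ i, X i t ω = 1) : X (U.chan t ω) t ω = 1 := by
  obtain ⟨h1, h2⟩ := hU t ω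
  by_cases h0 : X (U.before t ω) t ω = 0
  · exact h1 ⟨h0, h⟩
  · rw [h2 fun hc => h0 hc.1]
    omega

theorem AlwaysGood.switchGain_term_nonneg {U : Control n ℱ} (hU : U.AlwaysGood X) (s t : ℝ≥0)
    {ω : Ω} : 0 ≤ ((X (U.chan t ω) t ω : ℕ) : ℝ) - ((X (U.chan s ω) t ω : ℕ) : ℝ) := by
  by_cases h : ∃ i, X i t ω = 1
  · rw [hU.state_eq_one h]
    simpa using val_le_one (X (U.chan s ω) t ω)
  · have h0 : ∀ i, X i t ω = 0 := fun i => by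
      push Not at h
      have := h i
      omega
    rw [h0, h0, sub_self]

theorem AlwaysGood.switchGain_nonneg {U : Control n ℱ} (hU : U.AlwaysGood X) (t : ℝ≥0) (K : ℕ)
    (ω : Ω) : 0 ≤ U.switchGain X t K ω :=
  Finset.sum_nonneg fun _ _ => hU.switchGain_term_nonneg _ _

/-- Converse to `switchGain_le` for `π^(a)`. On a fine enough mesh the given switches lie in
distinct cells; the left node still carries the old channel and the right node the states at the
switch, so such a cell contributes exactly 1. The remaining terms are nonnegative. -/
theorem AlwaysGood.eventually_card_le {U : Control n ℱ} (hU : U.AlwaysGood X)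
    (hX : IsChannelSystem γ μ ℱ X) {t : ℝ≥0} (ht : 0 < t) (ω : Ω) (F : Finset ℝ≥0)
    (hF : ∀ s ∈ F, 0 < s ∧ s ≤ t ∧ U.before s ω ≠ U.chan s ω) :
    ∀ᶠ K : ℕ in atTop, (F.card : ℝ) ≤ U.switchGain X t K ω := by
  have hmesh : ∀ ε : ℝ≥0, 0 < ε → ∀ᶠ K : ℕ in atTop, mesh t K < ε := fun ε hε =>
    (tendsto_mesh t).eventually_lt_const hε
  have hev : ∀ᶠ K : ℕ in atTop, ∀ s ∈ F,
      (∀ r, r < s → s ≤ r + mesh t K → U.chan r ω = U.before s ω) ∧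
      (∀ r, s ≤ r → r ≤ s + mesh t K → ∀ i, X i r ω = X i s ω) := by
    rw [Filter.eventually_all_finset]
    intro s hs
    obtain ⟨hs0, -, -⟩ := hF s hs
    refine Filter.Eventually.and ?_ ?_
    · obtain ⟨l, hl, hl'⟩ := (mem_nhdsLT_iff_exists_Ioo_subset' hs0).mp (U.eventually_before hs0 ω)
      filter_upwards [hmesh (s - l) (tsub_pos_of_lt hl)] with K hK r hr hr'
      refine hl' ⟨?_, hr⟩
      by_contra hcon
      push Not at hcon
      have h1 : s < l + (s - l) := (hr'.trans (add_le_add_left hcon _)).trans_lt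
        (add_lt_add_right hK l)
      rw [add_tsub_cancel_of_le (le_of_lt hl)] at h1
      exact lt_irrefl _ h1
    · have h1 : ∀ᶠ r in 𝓝[≥] s, ∀ i, X i r ω = X i s ω :=
        eventually_all.mpr fun i => (hX.cadlag i ω).eventually_right s
      obtain ⟨u, hu, hu'⟩ := (mem_nhdsGE_iff_exists_Ico_subset' (lt_add_one s)).mp h1
      filter_upwards [hmesh (u - s) (tsub_pos_of_lt hu)] with K hK r hr hr'
      refine hu' ⟨hr, hr'.trans_lt ?_⟩
      have h2 := add_lt_add_right hK s
      rwa [add_tsub_cancel_of_le (le_of_lt hu)] at h2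
  filter_upwards [hev] with K hK
  have hpos := mesh_pos ht K
  have hindex : ∀ s ∈ F, ∃ j : ℕ, j < K + 1 ∧ j * mesh t K < s ∧ s ≤ (j + 1 : ℕ) * mesh t K := by
    intro s hs
    obtain ⟨hs0, hst, -⟩ := hF s hs
    have hc0 : 0 < ⌈s / mesh t K⌉₊ := Nat.ceil_pos.mpr (div_pos hs0 hpos)
    obtain ⟨j, hj⟩ := Nat.exists_eq_succ_of_ne_zero hc0.ne'
    have hj' := (Nat.ceil_eq_iff (Nat.succ_ne_zero j)).mp hj
    rw [lt_div_iff₀ hpos, div_le_iff₀ hpos] at hj'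
    have hj1 : (j : ℝ≥0) * mesh t K < s := by simpa using hj'.1
    refine ⟨j, ?_, hj1, hj'.2⟩
    have h3 : (j : ℝ≥0) * mesh t K < (K + 1) * mesh t K := by
      rw [succ_mul_mesh]
      exact hj1.trans_le hst
    exact_mod_cast lt_of_mul_lt_mul_right h3 hpos.le
  choose! J hJ using hindex
  have hnode : ∀ s ∈ F, U.chan (J s * mesh t K) ω = U.before s ω := by
    intro s hs
    obtain ⟨-, h1, h2⟩ := hJ s hs
    refine (hK s hs).1 _ h1 (h2.trans_eq ?_)
    push_cast
    ring
  have hterm : ∀ s ∈ F,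
      ((X (U.chan ((J s + 1 : ℕ) * mesh t K) ω) ((J s + 1 : ℕ) * mesh t K) ω : ℕ) : ℝ) -
      ((X (U.chan (J s * mesh t K) ω) ((J s + 1 : ℕ) * mesh t K) ω : ℕ) : ℝ) = 1 := by
    intro s hs
    obtain ⟨-, h1, h2⟩ := hJ s hs
    obtain ⟨-, -, hne⟩ := hF s hs
    have hsw : X (U.before s ω) s ω = 0 ∧ ∃ j, X j s ω = 1 := by
      by_contra hcon
      exact hne ((hU s ω).2 hcon).symm
    have hconst : ∀ i, X i ((J s + 1 : ℕ) * mesh t K) ω = X i s ω := by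
      refine (hK s hs).2 _ h2 ?_
      have h3 := add_le_add_left h1.le (mesh t K)
      refine le_trans (le_of_eq ?_) h3
      push_cast
      ring
    have hgood : ∃ i, X i ((J s + 1 : ℕ) * mesh t K) ω = 1 := by
      obtain ⟨i, hi⟩ := hsw.2
      exact ⟨i, (hconst i).trans hi⟩
    rw [hU.state_eq_one hgood, hnode s hs, hconst, hsw.1]
    simp
  have hinj : Set.InjOn J F := by
    -- If `s < s'` shared a cell, the channel at `s` and at the left node would both be the one in
    -- use just before `s'`, so nothing would change at `s`.
    have hlt : ∀ s ∈ F, ∀ s' ∈ F, s < s' → J s ≠ J s' := by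
      intro s hs s' hs' hss heq
      obtain ⟨-, h1, h2⟩ := hJ s hs
      obtain ⟨-, -, h2'⟩ := hJ s' hs'
      obtain ⟨-, -, hne⟩ := hF s hs
      apply hne
      rw [← hnode s hs, heq, hnode s' hs']
      refine ((hK s' hs').1 s hss (h2'.trans ?_)).symm
      have h3 := add_le_add_left h1.le (mesh t K)
      refine le_trans (le_of_eq ?_) h3
      rw [heq]
      push_cast
      ring
    intro s hs s' hs' heq
    rcases lt_trichotomy s s' with h | h | h
    · exact absurd heq (hlt s hs s' hs' h)
    · exact h
    · exact absurd heq.symm (hlt s' hs' s hs h)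
  calc (F.card : ℝ) = ∑ j ∈ F.image J, (1 : ℝ) := by
        rw [Finset.sum_const, Finset.card_image_of_injOn hinj]
        simp
    _ = ∑ j ∈ F.image J,
        (((X (U.chan ((j + 1 : ℕ) * mesh t K) ω) ((j + 1 : ℕ) * mesh t K) ω : ℕ) : ℝ) -
        ((X (U.chan (j * mesh t K) ω) ((j + 1 : ℕ) * mesh t K) ω : ℕ) : ℝ)) := by
        refine Finset.sum_congr rfl fun j hj => ?_
        obtain ⟨s, hs, rfl⟩ := Finset.mem_image.mp hj
        exact (hterm s hs).symm
    _ ≤ U.switchGain X t K ω := by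
        refine Finset.sum_le_sum_of_subset_of_nonneg ?_ fun j _ _ => hU.switchGain_term_nonneg _ _
        intro j hj
        obtain ⟨s, hs, rfl⟩ := Finset.mem_image.mp hj
        exact Finset.mem_range.mpr (hJ s hs).1

/-- The summand 1 pays for a possible switch at time 0, which partition sums do not see. Stating the
bound with a `liminf` prepares for Fatou; an infinite set of switches has finite subsets of every
size and forces the `liminf` to be `⊤`. -/
theorem AlwaysGood.numSwitches_le {U : Control n ℱ} (hU : U.AlwaysGood X)
    (hX : IsChannelSystem γ μ ℱ X) {t : ℝ≥0} (ht : 0 < t) (ω : Ω) :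
    (U.numSwitches t ω : ℝ≥0∞) ≤
      1 + liminf (fun K => ENNReal.ofReal (U.switchGain X t K ω)) atTop := by
  set S : Set ℝ≥0 := {s | 0 < s ∧ s ≤ t ∧ U.before s ω ≠ U.chan s ω} with hS
  have hfin : ∀ F : Finset ℝ≥0, (F : Set ℝ≥0) ⊆ S →
      (F.card : ℝ≥0∞) ≤ liminf (fun K => ENNReal.ofReal (U.switchGain X t K ω)) atTop := by
    intro F hF
    refine le_liminf_of_le (by isBoundedDefault) ?_
    filter_upwards [hU.eventually_card_le hX ht ω F fun s hs => hF hs] with K hK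
    rw [← ENNReal.ofReal_natCast]
    exact ENNReal.ofReal_le_ofReal hK
  have hle : U.numSwitches t ω ≤ 1 + S.encard := by
    rw [numSwitches, ← Set.encard_singleton (0 : ℝ≥0)]
    refine (Set.encard_le_encard ?_).trans (Set.encard_union_le _ _)
    intro s hs
    rcases eq_or_ne s 0 with h | h
    · exact Or.inl h
    · exact Or.inr ⟨pos_iff_ne_zero.mpr h, hs.1, hs.2⟩
  rw [← ENat.toENNReal_le] at hle
  refine hle.trans ?_
  rw [ENat.toENNReal_add, ENat.toENNReal_one]
  refine add_le_add_right ?_ 1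
  rcases S.finite_or_infinite with hfinite | hinf
  · have h := hfin hfinite.toFinset (by simp)
    rwa [hfinite.encard_eq_coe_toFinset_card, ENat.toENNReal_coe]
  · have htop : liminf (fun K => ENNReal.ofReal (U.switchGain X t K ω)) atTop = ⊤ := by
      rw [eq_top_iff, ← ENNReal.iSup_natCast]
      refine iSup_le fun k => ?_
      obtain ⟨F, hF, hcard⟩ := hinf.exists_subset_card_eq k
      rw [← hcard]
      exact hfin F hF
    rw [htop]
    exact le_top

end Control

end Discretization

/-! ### Construction of the two policies as controls. -/

section Existence

variable {n : ℕ}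

open Classical in
/-- The channel in use after the policy has reacted to the states `x`, when `u` was in use. -/
def react (x : Fin n → Fin 2) (u : Fin n) : Fin n :=
  if h : x u = 0 ∧ ∃ j, x j = 1 then h.2.choose else u

theorem react_of_bad {x : Fin n → Fin 2} {u : Fin n} (h : x u = 0 ∧ ∃ j, x j = 1) :
    x (react x u) = 1 := by
  rw [react, dif_pos h]
  exact h.2.choose_spec

theorem react_of_not {x : Fin n → Fin 2} {u : Fin n} (h : ¬(x u = 0 ∧ ∃ j, x j = 1)) :
    react x u = u := by
  rw [react, dif_neg h]

theorem react_react (x : Fin n → Fin 2) (u : Fin n) : react x (react x u) = react x u := by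
  by_cases h : x u = 0 ∧ ∃ j, x j = 1
  · refine react_of_not fun hc => ?_
    rw [react_of_bad h] at hc
    exact one_ne_zero hc.1
  · rw [react_of_not h, react_of_not h]

/-- The channel in use at time `j / (k + 1)` if the policy reacts at multiples of `1 / (k + 1)`
only. -/
def gridChan (x : ℝ≥0 → Fin n → Fin 2) (u : Fin n) (k : ℕ) : ℕ → Fin n
  | 0 => react (x 0) u
  | j + 1 => react (x ((j + 1 : ℕ) / (k + 1))) (gridChan x u k j)

/-- The channel in use at time `t` if the policy reacts at time `t` and, before, at multiples of
`1 / (k + 1)` only. -/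
def approxChan (x : ℝ≥0 → Fin n → Fin 2) (u : Fin n) (k : ℕ) (t : ℝ≥0) : Fin n :=
  react (x t) (gridChan x u k ⌊t * (k + 1)⌋₊)

theorem approxChan_zero (x : ℝ≥0 → Fin n → Fin 2) (u : Fin n) (k : ℕ) :
    approxChan x u k 0 = react (x 0) u := by
  rw [approxChan, zero_mul, Nat.floor_zero, gridChan, react_react]

/-- While the states stay constant, all further grid reactions collapse into one, because `react` is
idempotent. -/
theorem react_gridChan {x : ℝ≥0 → Fin n → Fin 2} (u : Fin n) (k : ℕ) {s : ℝ≥0} {j : ℕ}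
    (hj : ⌊s * (k + 1)⌋₊ ≤ j) (hx : ∀ r, s ≤ r → r ≤ j / (k + 1) → x r = x s) :
    react (x s) (gridChan x u k j) = approxChan x u k s := by
  induction j, hj using Nat.le_induction with
  | base => rfl
  | succ j hj ih =>
    have hk : (0 : ℝ≥0) < k + 1 := by positivity
    have hs : s ≤ (j + 1 : ℕ) / (k + 1) := by
      rw [le_div_iff₀ hk]
      exact (Nat.lt_of_floor_lt (Nat.lt_succ_of_le hj)).le
    rw [gridChan, hx _ hs le_rfl, react_react]
    refine ih fun r hr hr' => hx r hr (hr'.trans ?_)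
    gcongr
    exact Nat.le_succ j

theorem approxChan_eq_of_const {x : ℝ≥0 → Fin n → Fin 2} (u : Fin n) (k : ℕ) {s t : ℝ≥0}
    (hst : s ≤ t) (hx : ∀ r, s ≤ r → r ≤ t → x r = x s) :
    approxChan x u k t = approxChan x u k s := by
  have hk : (0 : ℝ≥0) < k + 1 := by positivity
  rw [approxChan, hx t hst le_rfl]
  refine react_gridChan u k (Nat.floor_mono (by gcongr)) fun r hr hr' => hx r hr (hr'.trans ?_)
  rw [div_le_iff₀ hk]
  exact Nat.floor_le bot_le

theorem gridChan_succ_of_const {x : ℝ≥0 → Fin n → Fin 2} (u : Fin n) (k : ℕ) {s t : ℝ≥0} {j : ℕ}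
    (hj : ⌊s * (k + 1)⌋₊ ≤ j) (hjt : ((j + 1 : ℕ) : ℝ≥0) / (k + 1) < t)
    (hx : ∀ r, s ≤ r → r < t → x r = x s) :
    gridChan x u k (j + 1) = approxChan x u k s := by
  have hk : (0 : ℝ≥0) < k + 1 := by positivity
  have hs : s ≤ (j + 1 : ℕ) / (k + 1) := by
    rw [le_div_iff₀ hk]
    exact (Nat.lt_of_floor_lt (Nat.lt_succ_of_le hj)).le
  rw [gridChan, hx _ hs hjt]
  refine react_gridChan u k hj fun r hr hr' => hx r hr (hr'.trans_lt (lt_of_le_of_lt ?_ hjt))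
  gcongr
  exact Nat.le_succ j

/-- The assumption on `k` puts a grid point strictly between `s` and `t`, so the grid policy has
already reacted to the states held on `[s, t)` before those at `t` appear. -/
theorem approxChan_eq_react {x : ℝ≥0 → Fin n → Fin 2} (u : Fin n) (k : ℕ) {s t : ℝ≥0}
    (hk : s + 1 / (k + 1) < t) (hx : ∀ r, s ≤ r → r < t → x r = x s) :
    approxChan x u k t = react (x t) (approxChan x u k s) := by
  have hk0 : (0 : ℝ≥0) < k + 1 := by positivity
  have hnext : ((⌊s * (k + 1)⌋₊ + 1 : ℕ) : ℝ≥0) / (k + 1) < t := by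
    refine lt_of_le_of_lt ?_ hk
    have h1 : (⌊s * (k + 1)⌋₊ : ℝ≥0) / (k + 1) ≤ s := by
      rw [div_le_iff₀ hk0]
      exact Nat.floor_le bot_le
    push_cast
    rw [add_div]
    gcongr
  have hle : ⌊s * (k + 1)⌋₊ + 1 ≤ ⌊t * (k + 1)⌋₊ := by
    rw [Nat.le_floor_iff bot_le, ← div_le_iff₀ hk0]
    exact hnext.le
  obtain ⟨i, hi⟩ : ∃ i, ⌊t * (k + 1)⌋₊ = i + 1 := ⟨⌊t * (k + 1)⌋₊ - 1, by omega⟩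
  have hfl : ((i + 1 : ℕ) : ℝ≥0) / (k + 1) ≤ t := by
    rw [← hi, div_le_iff₀ hk0]
    exact Nat.floor_le bot_le
  rw [approxChan, hi]
  -- If the last grid point is `t` itself, the grid policy has also reacted to `x t` once;
  -- idempotence absorbs this, and the preceding grid point is used instead.
  rcases hfl.lt_or_eq with hlt | heq
  · rw [gridChan_succ_of_const u k (by omega) hlt hx]
  · have hlt : ⌊s * (k + 1)⌋₊ < i := by
      rw [← heq, div_lt_div_iff_of_pos_right hk0] at hnext
      have := Nat.cast_lt.mp hnext
      omega
    obtain ⟨i', rfl⟩ : ∃ i', i = i' + 1 := ⟨i - 1, by omega⟩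
    rw [gridChan, heq, react_react, gridChan_succ_of_const u k (by omega) ?_ hx]
    rw [← heq]
    gcongr
    exact Nat.lt_succ_self _

theorem eventually_right_states {x : ℝ≥0 → Fin n → Fin 2} (hx : ∀ i, IsCadlag fun t => x t i)
    (t : ℝ≥0) : ∃ r, t < r ∧ ∀ s, t ≤ s → s < r → x s = x t := by
  have h1 : ∀ᶠ s in 𝓝[≥] t, ∀ i, x s i = x t i :=
    eventually_all.mpr fun i => (hx i).eventually_right t
  obtain ⟨r, hr, hr'⟩ := (mem_nhdsGE_iff_exists_Ico_subset' (lt_add_one t)).mp h1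
  exact ⟨r, hr, fun s hs hs' => funext fun i => hr' ⟨hs, hs'⟩ i⟩

theorem eventually_left_states {x : ℝ≥0 → Fin n → Fin 2} (hx : ∀ i, IsCadlag fun t => x t i)
    {t : ℝ≥0} (ht : 0 < t) : ∃ l, l < t ∧ ∀ r s, l < r → r ≤ s → s < t → x s = x r := by
  choose y hy using fun i => (hx i).eventually_left ht
  have h1 : ∀ᶠ s in 𝓝[<] t, ∀ i, x s i = y i := eventually_all.mpr hy
  obtain ⟨l, hl, hl'⟩ := (mem_nhdsLT_iff_exists_Ioo_subset' ht).mp h1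
  refine ⟨l, hl, fun r s hr hrs hs => funext fun i => ?_⟩
  exact (hl' ⟨hr.trans_le hrs, hs⟩ i).trans (hl' ⟨hr, hrs.trans_lt hs⟩ i).symm

theorem eventually_approxChan_eq_react {x : ℝ≥0 → Fin n → Fin 2} (u : Fin n) {s t : ℝ≥0}
    (hst : s < t) (hx : ∀ r, s ≤ r → r < t → x r = x s) :
    ∀ᶠ k : ℕ in atTop, approxChan x u k t = react (x t) (approxChan x u k s) := by
  have hlim : Tendsto (fun k : ℕ => s + 1 / ((k : ℝ≥0) + 1)) atTop (𝓝 s) := by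
    simpa using (tendsto_const_nhds (x := s)).add
      (tendsto_one_div_add_atTop_nhds_zero_nat (𝕜 := ℝ≥0))
  filter_upwards [hlim.eventually_lt_const hst] with k hk
  exact approxChan_eq_react u k hk hx

/-- Induction along the continuum: the set of times at which the approximations stabilise contains
0, is closed, and extends to the right of each of its points. This avoids enumerating the jump
times. -/
theorem exists_eventually_approxChan_eq {x : ℝ≥0 → Fin n → Fin 2}
    (hx : ∀ i, IsCadlag fun t => x t i) (u : Fin n) (t : ℝ≥0) :
    ∃ v, ∀ᶠ k : ℕ in atTop, approxChan x u k t = v := by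
  set A : Set ℝ≥0 := {t | ∃ v, ∀ᶠ k : ℕ in atTop, approxChan x u k t = v} with hA
  have h0 : (0 : ℝ≥0) ∈ A := ⟨react (x 0) u, Eventually.of_forall fun k => approxChan_zero x u k⟩
  have hright : ∀ t, ∃ r, t < r ∧ ∀ s, t ≤ s → s < r → (s ∈ A ↔ t ∈ A) := by
    intro t
    obtain ⟨r, hr, hr'⟩ := eventually_right_states hx t
    refine ⟨r, hr, fun s hs hs' => ?_⟩
    have h1 : ∀ k, approxChan x u k s = approxChan x u k t := fun k =>
      approxChan_eq_of_const u k hs fun q hq hq' => hr' q hq (hq'.trans_lt hs')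
    simp only [hA, mem_ofPred_eq, h1]
  have hclosed : IsClosed A := by
    rw [← isOpen_compl_iff, isOpen_iff_mem_nhds]
    intro t ht
    have ht0 : 0 < t := pos_iff_ne_zero.mpr fun h => ht (h ▸ h0)
    rw [← nhdsLT_sup_nhdsGE, mem_sup]
    constructor
    · obtain ⟨l, hl, hl'⟩ := eventually_left_states hx ht0
      filter_upwards [Ioo_mem_nhdsLT hl] with s hs hsA
      obtain ⟨v, hv⟩ := hsA
      refine ht ⟨react (x t) v, ?_⟩
      filter_upwards [hv, eventually_approxChan_eq_react u hs.2
        fun r hr hr' => hl' s r hs.1 hr hr'] with k hk hk'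
      rw [hk', hk]
    · obtain ⟨r, hr, hr'⟩ := hright t
      filter_upwards [Ico_mem_nhdsGE hr] with s hs hsA
      exact ht ((hr' s hs.1 hs.2).mp hsA)
  refine (hclosed.inter isClosed_Icc).Icc_subset_of_forall_mem_nhdsWithin h0 ?_
    (right_mem_Icc.mpr zero_le)
  rintro s ⟨hs, -⟩
  obtain ⟨r, hr, hr'⟩ := hright s
  filter_upwards [Ioo_mem_nhdsGT hr] with q hq
  exact (hr' q hq.1.le hq.2).mpr hs

variable {Ω : Type*} {m : MeasurableSpace Ω} {γ : ℝ} {μ : Measure Ω}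
  {ℱ : Filtration ℝ≥0 m} {X : Fin n → ℝ≥0 → Ω → Fin 2}

theorem measurable_react {m' : MeasurableSpace Ω} {u : Ω → Fin n} (hu : Measurable[m'] u)
    {Y : Fin n → Ω → Fin 2} (hY : ∀ i, Measurable[m'] (Y i)) :
    Measurable[m'] (fun ω => react (fun i => Y i ω) (u ω)) := by
  have h : Measurable[m'] (fun ω => (u ω, fun i => Y i ω)) :=
    hu.prodMk (measurable_pi_lambda _ hY)
  exact (measurable_of_countable (fun p : Fin n × (Fin n → Fin 2) => react p.2 p.1)).comp h

theorem measurable_gridChan (hX : ∀ i, Adapted ℱ (X i)) {u : Ω → Fin n} (hu : Measurable[ℱ 0] u)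
    (k j : ℕ) :
    Measurable[ℱ (j / (k + 1))] fun ω => gridChan (fun t i => X i t ω) (u ω) k j := by
  induction j with
  | zero =>
    have h0 : ((0 : ℕ) : ℝ≥0) / (k + 1) = 0 := by simp
    rw [h0]
    exact measurable_react hu fun i => hX i 0
  | succ j ih =>
    have hle : (j : ℝ≥0) / (k + 1) ≤ (j + 1 : ℕ) / (k + 1) := by
      gcongr
      exact Nat.le_succ j
    exact measurable_react (ih.mono (ℱ.mono hle) le_rfl) fun i => hX i _

theorem measurable_approxChan (hX : ∀ i, Adapted ℱ (X i)) {u : Ω → Fin n}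
    (hu : Measurable[ℱ 0] u) (k : ℕ) (t : ℝ≥0) :
    Measurable[ℱ t] fun ω => approxChan (fun t i => X i t ω) (u ω) k t := by
  have hk : (0 : ℝ≥0) < k + 1 := by positivity
  refine measurable_react ((measurable_gridChan hX hu k _).mono (ℱ.mono ?_) le_rfl) fun i => hX i t
  rw [div_le_iff₀ hk]
  exact Nat.floor_le bot_le

/-- The control is the pointwise eventual value of the grid approximations. Each approximation at
time `t` is `ℱ t`-measurable, and eventual equality is a countable set operation, so the limit is
adapted. -/
theorem exists_alwaysGood (hX : IsChannelSystem γ μ ℱ X) {u : Ω → Fin n}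
    (hu : Measurable[ℱ 0] u) : ∃ U : Control n ℱ, U.init = u ∧ U.AlwaysGood X := by
  have hex : ∀ t ω, ∃ v, ∀ᶠ k : ℕ in atTop, approxChan (fun t i => X i t ω) (u ω) k t = v :=
    fun t ω => exists_eventually_approxChan_eq (fun i => hX.cadlag i ω) (u ω) t
  choose V hV using hex
  have hVeq : ∀ t ω v, (∀ᶠ k : ℕ in atTop, approxChan (fun t i => X i t ω) (u ω) k t = v) →
      V t ω = v := fun t ω v h => by
    obtain ⟨k, hk, hk'⟩ := ((hV t ω).and h).exists
    exact hk.symm.trans hk'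
  have hconst : ∀ ω s t, s ≤ t →
      (∀ r, s ≤ r → r ≤ t → (fun i => X i r ω) = fun i => X i s ω) → V t ω = V s ω := by
    intro ω s t hst hx
    refine hVeq t ω _ ((hV s ω).mono fun k hk => ?_)
    rw [approxChan_eq_of_const (x := fun t i => X i t ω) (u ω) k hst hx, hk]
  -- Gives the left limit together with the defining relation of the policy: the channel at `t` is
  -- the reaction to the left limit.
  have hleft : ∀ ω t, 0 < t → ∃ w, (∀ᶠ s in 𝓝[<] t, V s ω = w) ∧
      V t ω = react (fun i => X i t ω) w := by
    intro ω t ht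
    obtain ⟨l, hl, hl'⟩ := eventually_left_states (x := fun t i => X i t ω)
      (fun i => hX.cadlag i ω) ht
    obtain ⟨s₀, h1, h2⟩ := exists_between hl
    refine ⟨V s₀ ω, ?_, ?_⟩
    · filter_upwards [Ioo_mem_nhdsLT h2] with s hs
      exact hconst ω s₀ s hs.1.le fun r hr hr' => hl' s₀ r h1 hr (hr'.trans_lt hs.2)
    · refine hVeq t ω _ ?_
      filter_upwards [hV s₀ ω, eventually_approxChan_eq_react (x := fun t i => X i t ω) (u ω) h2
        fun r hr hr' => hl' s₀ r h1 hr hr'] with k hk hk'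
      rw [hk', hk]
  have hmeas : ∀ t, Measurable[ℱ t] (V t) := by
    intro t
    refine @measurable_to_countable' (Fin n) Ω _ _ (ℱ t) (V t) fun v => ?_
    have hset : V t ⁻¹' {v} =
        {ω | ∀ᶠ k : ℕ in atTop, approxChan (fun t i => X i t ω) (u ω) k t = v} := by
      ext ω
      exact ⟨fun h => h ▸ hV t ω, fun h => hVeq t ω v h⟩
    have hset' : {ω | ∀ᶠ k : ℕ in atTop, approxChan (fun t i => X i t ω) (u ω) k t = v} =
        ⋃ K : ℕ, ⋂ k : ℕ, ⋂ _ : K ≤ k, {ω | approxChan (fun t i => X i t ω) (u ω) k t = v} := by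
      ext ω
      simp [eventually_atTop]
    rw [hset, hset']
    exact MeasurableSet.iUnion fun K => MeasurableSet.iInter fun k => MeasurableSet.iInter fun _ =>
      measurable_approxChan hX.adapted hu k t (measurableSet_singleton v)
  let U : Control n ℱ :=
    { init := u
      chan := V
      init_measurable := hu
      adapted := hmeas
      cadlag := fun ω => by
        refine ⟨fun t => ?_, fun t ht => ?_⟩
        · obtain ⟨r, hr, hr'⟩ := eventually_right_states (x := fun t i => X i t ω)
            (fun i => hX.cadlag i ω) t
          rw [ContinuousWithinAt, nhds_discrete, tendsto_pure]
          filter_upwards [Ico_mem_nhdsGE hr] with s hs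
          exact hconst ω t s hs.1 fun q hq hq' => hr' q hq (hq'.trans_lt hs.2)
        · obtain ⟨w, hw, -⟩ := hleft ω t ht
          refine ⟨w, ?_⟩
          rw [nhds_discrete, tendsto_pure]
          exact hw }
  have hU : ∀ t ω, U.chan t ω = react (fun i => X i t ω) (U.before t ω) := by
    intro t ω
    rcases eq_or_ne t 0 with rfl | ht
    · rw [U.before_zero]
      exact hVeq 0 ω _ (Eventually.of_forall fun k => approxChan_zero _ _ _)
    · obtain ⟨w, hw, hw'⟩ := hleft ω t (pos_iff_ne_zero.mpr ht)
      rw [U.before_eq_of_eventually (pos_iff_ne_zero.mpr ht) hw]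
      exact hw'
  refine ⟨U, rfl, fun t ω => ⟨fun h => ?_, fun h => ?_⟩⟩
  · rw [hU]
    exact react_of_bad (x := fun i => X i t ω) h
  · rw [hU]
    exact react_of_not (x := fun i => X i t ω) h

theorem exists_neverSwitches {u : Ω → Fin n} (hu : Measurable[ℱ 0] u) :
    ∃ U : Control n ℱ, U.init = u ∧ U.NeverSwitches := by
  let U : Control n ℱ :=
    { init := u
      chan := fun _ => u
      init_measurable := hu
      adapted := fun t => hu.mono (ℱ.mono zero_le) le_rfl
      cadlag := fun ω => ⟨fun t => continuousWithinAt_const, fun t _ => ⟨u ω, tendsto_const_nhds⟩⟩ }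
  refine ⟨U, rfl, fun t ω => ?_⟩
  rcases eq_or_ne t 0 with rfl | ht
  · rw [U.before_zero]
  · exact (U.before_eq_of_eventually (pos_iff_ne_zero.mpr ht)
      (Eventually.of_forall fun _ => rfl)).symm

end Existence

/-! ### Reward and switching bounds, and the long-run averages. -/

section AverageReward

variable {Ω : Type*} {m : MeasurableSpace Ω} {n : ℕ} {γ : ℝ} {μ : Measure Ω}
  {ℱ : Filtration ℝ≥0 m} {X : Fin n → ℝ≥0 → Ω → Fin 2}

/-- `N` need not be measurable, so this applies to `numSwitches`, which counts over an uncountable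
set of times. -/
theorem ofReal_integral_le_lintegral {f : Ω → ℝ} (hf : Integrable f μ) {N : Ω → ℝ≥0∞}
    (h : ∀ ω, ENNReal.ofReal (f ω) ≤ N ω) : ENNReal.ofReal (∫ ω, f ω ∂μ) ≤ ∫⁻ ω, N ω ∂μ := by
  have hpos : Integrable (fun ω => max (f ω) 0) μ := hf.pos_part
  calc ENNReal.ofReal (∫ ω, f ω ∂μ) ≤ ENNReal.ofReal (∫ ω, max (f ω) 0 ∂μ) :=
        ENNReal.ofReal_le_ofReal (integral_mono hf hpos fun ω => le_max_left _ _)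
    _ = ∫⁻ ω, ENNReal.ofReal (max (f ω) 0) ∂μ :=
        ofReal_integral_eq_lintegral_ofReal hpos (Eventually.of_forall fun ω => le_max_right _ _)
    _ ≤ ∫⁻ ω, N ω ∂μ := by
        refine lintegral_mono fun ω => ?_
        simpa [ENNReal.ofReal_max] using h ω

/-- A right-endpoint Riemann sum of a decreasing function lies below its integral; here `∫₀^∞
e^(-s/γ) ds = γ`. The induction runs on the sharper bound by the integral up to `N h`. -/
theorem mul_sum_exp_le (hγ : 0 < γ) (h : ℝ≥0) (N : ℕ) :
    (h : ℝ) * ∑ j ∈ Finset.range N, Real.exp (-((((j + 1 : ℕ) : ℝ≥0) * h : ℝ≥0) / γ)) ≤ γ := by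
  suffices hs : (h : ℝ) * ∑ j ∈ Finset.range N, Real.exp (-((((j + 1 : ℕ) : ℝ≥0) * h : ℝ≥0) / γ)) ≤
      γ * (1 - Real.exp (-(((N : ℝ≥0) * h : ℝ≥0) / γ))) by
    refine hs.trans (mul_le_of_le_one_right hγ.le ?_)
    linarith [Real.exp_pos (-(((N : ℝ≥0) * h : ℝ≥0) / γ))]
  induction N with
  | zero => simp
  | succ N ih =>
    rw [Finset.sum_range_succ, mul_add]
    have h1 : Real.exp (-(((N : ℝ≥0) * h : ℝ≥0) / γ)) =
        Real.exp (-((((N + 1 : ℕ) : ℝ≥0) * h : ℝ≥0) / γ)) * Real.exp (h / γ) := by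
      rw [← Real.exp_add]
      congr 1
      push_cast
      ring
    have h2 : (h : ℝ) ≤ γ * (Real.exp (h / γ) - 1) := by
      have h3 := mul_le_mul_of_nonneg_left (Real.add_one_le_exp ((h : ℝ) / γ)) hγ.le
      rw [mul_add, mul_div_cancel₀ _ hγ.ne'] at h3
      linarith
    have h4 := mul_le_mul_of_nonneg_right h2
      (Real.exp_pos (-((((N + 1 : ℕ) : ℝ≥0) * h : ℝ≥0) / γ))).le
    rw [h1] at ih
    linarith

theorem pow_one_sub_le (hn : 1 ≤ n) (hγ0 : 0 < γ) (hγ1 : γ < 1) :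
    (1 - γ) ^ n ≤ 1 - γ :=
  pow_le_of_le_one (by linarith) (by linarith) (by omega)

theorem tendsto_add_div (L C : ℝ) :
    Tendsto (fun t : ℝ≥0 => L + C / (t : ℝ)) atTop (𝓝 L) := by
  have h := (tendsto_const_nhds (x := L)).add
    ((tendsto_const_nhds (x := C)).div_atTop (NNReal.tendsto_coe_atTop.mpr tendsto_id))
  simpa using h

namespace Control

theorem rate_nonneg (U : Control n ℱ) (s : ℝ≥0) : 0 ≤ U.rate μ X s :=
  integral_nonneg fun _ => Nat.cast_nonneg _

theorem rate_le_one [IsProbabilityMeasure μ] (hX : IsChannelSystem γ μ ℱ X) (U : Control n ℱ)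
    (s : ℝ≥0) : U.rate μ X s ≤ 1 := by
  refine (integral_mono (integrable_select hX (U.measurable_chan s) s)
    (integrable_const (1 : ℝ)) fun ω => val_le_one _).trans ?_
  simp

theorem expectedReward_le_of_rate_le [IsProbabilityMeasure μ] (hX : IsChannelSystem γ μ ℱ X)
    (hγ : 0 < γ) (U : Control n ℱ) {L C : ℝ} (hC : 0 ≤ C)
    (hrate : ∀ s : ℝ≥0, U.rate μ X s ≤ L + C * Real.exp (-(s / γ))) {t : ℝ≥0} (ht : 0 < t) :
    U.expectedReward μ X t ≤ L * t + C * γ := by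
  refine le_of_tendsto (U.tendsto_expectedReward hX ht) (Eventually.of_forall fun K => ?_)
  have h1 := Finset.sum_le_sum fun j (_ : j ∈ Finset.range (K + 1)) =>
    hrate ((j + 1 : ℕ) * mesh t K)
  have h2 := mul_le_mul_of_nonneg_left h1 (mesh t K).coe_nonneg
  have h3 := mul_le_mul_of_nonneg_left (mul_sum_exp_le hγ (mesh t K) (K + 1)) hC
  have h4 := coe_succ_mul_mesh t K
  rw [Finset.sum_add_distrib, ← Finset.mul_sum, Finset.sum_const, Finset.card_range,
    nsmul_eq_mul] at h2
  refine h2.trans ?_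
  rw [← h4]
  push_cast at h3 ⊢
  linarith

theorem le_expectedReward_of_le_rate [IsProbabilityMeasure μ] (hX : IsChannelSystem γ μ ℱ X)
    (hγ : 0 < γ) (U : Control n ℱ) {L C : ℝ} (hC : 0 ≤ C)
    (hrate : ∀ s : ℝ≥0, L - C * Real.exp (-(s / γ)) ≤ U.rate μ X s) {t : ℝ≥0} (ht : 0 < t) :
    L * t - C * γ ≤ U.expectedReward μ X t := by
  refine ge_of_tendsto (U.tendsto_expectedReward hX ht) (Eventually.of_forall fun K => ?_)
  have h1 := Finset.sum_le_sum fun j (_ : j ∈ Finset.range (K + 1)) =>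
    hrate ((j + 1 : ℕ) * mesh t K)
  have h2 := mul_le_mul_of_nonneg_left h1 (mesh t K).coe_nonneg
  have h3 := mul_le_mul_of_nonneg_left (mul_sum_exp_le hγ (mesh t K) (K + 1)) hC
  have h4 := coe_succ_mul_mesh t K
  rw [Finset.sum_sub_distrib, ← Finset.mul_sum, Finset.sum_const, Finset.card_range,
    nsmul_eq_mul] at h2
  refine le_trans ?_ h2
  rw [← h4]
  push_cast at h3 ⊢
  linarith

theorem integrable_switchGain [IsProbabilityMeasure μ] (hX : IsChannelSystem γ μ ℱ X)
    (U : Control n ℱ) (t : ℝ≥0) (K : ℕ) : Integrable (U.switchGain X t K) μ :=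
  integrable_finsetSum _ fun _ _ => (integrable_select hX (U.measurable_chan _) _).sub
    (integrable_select hX (U.measurable_chan _) _)

/-- In each cell the increment of `rate` is the gain by switching plus the drift of the channel held
at the left node. By `meanState_add` that drift is `-(1 - e^(-h/γ))` times the excess of `rate` over
`γ`; the increments telescope. -/
theorem integral_switchGain [IsProbabilityMeasure μ] (hX : IsChannelSystem γ μ ℱ X)
    (hγ : γ ≠ 0) (U : Control n ℱ) (t : ℝ≥0) (K : ℕ) :
    ∫ ω, U.switchGain X t K ω ∂μ = U.rate μ X ((K + 1 : ℕ) * mesh t K) - U.rate μ X 0 +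
      (1 - Real.exp (-(mesh t K / γ))) *
        ∑ j ∈ Finset.range (K + 1), (U.rate μ X (j * mesh t K) - γ) := by
  have hi : ∀ s r, Integrable (fun ω => ((X (U.chan s ω) r ω : ℕ) : ℝ)) μ := fun s r =>
    integrable_select hX (U.measurable_chan s) r
  have hterm : ∀ j : ℕ,
      ∫ ω, (((X (U.chan ((j + 1 : ℕ) * mesh t K) ω) ((j + 1 : ℕ) * mesh t K) ω : ℕ) : ℝ) -
        ((X (U.chan (j * mesh t K) ω) ((j + 1 : ℕ) * mesh t K) ω : ℕ) : ℝ)) ∂μ =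
      (U.rate μ X ((j + 1 : ℕ) * mesh t K) - U.rate μ X (j * mesh t K)) +
        (1 - Real.exp (-(mesh t K / γ))) * (U.rate μ X (j * mesh t K) - γ) := by
    intro j
    have h1 := hX.meanState_add hγ (j * mesh t K) (mesh t K) (U.adapted (j * mesh t K))
    have hnode : (j : ℝ≥0) * mesh t K + mesh t K = (j + 1 : ℕ) * mesh t K := by
      push_cast
      ring
    rw [hnode, meanState] at h1
    rw [integral_sub (hi _ _) (hi _ _), h1]
    simp only [rate, meanState]
    ring
  simp only [switchGain]
  rw [integral_finsetSum, Finset.sum_congr rfl fun j _ => hterm j, Finset.sum_add_distrib, ← Finset.mul_sum,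
    Finset.sum_range_sub (fun j : ℕ => U.rate μ X (j * mesh t K))]
  · simp
  · exact fun j _ => (hi _ _).sub (hi _ _)

/-- Each unit of reward above the stationary one has to be paid for by channel changes. -/
theorem expectedReward_le_switches [IsProbabilityMeasure μ] (hX : IsChannelSystem γ μ ℱ X)
    (hγ : 0 < γ) (U : Control n ℱ) {t : ℝ≥0} (ht : 0 < t) (hfin : U.expectedSwitches μ t ≠ ⊤) :
    U.expectedReward μ X t ≤ γ * t + γ * (U.expectedSwitches μ t).toReal + γ := by
  set N := (U.expectedSwitches μ t).toReal with hN
  set S : ℕ → ℝ := fun K => (mesh t K : ℝ) *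
    ∑ j ∈ Finset.range (K + 1), (U.rate μ X (j * mesh t K) - γ) with hS
  have hN0 : 0 ≤ N := ENNReal.toReal_nonneg
  -- The exponential factor allows replacing `1 - e^(-h/γ)` by `h/γ` in the favourable direction,
  -- and tends to 1 with the mesh. The replacement needs a nonnegative sum, hence the case split on
  -- the sign of `S K`.
  have hbound : ∀ K, Real.exp (-(mesh t K / γ)) * S K ≤ γ * (N + 1) := by
    intro K
    have hpos : (0 : ℝ) < mesh t K := mesh_pos ht K
    rcases le_or_gt (S K) 0 with h0 | h0
    · exact (mul_nonpos_of_nonneg_of_nonpos (Real.exp_pos _).le h0).trans (by positivity)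
    have h1 := ofReal_integral_le_lintegral (U.integrable_switchGain hX t K)
      (U.switchGain_le X t K)
    have h2 := (ENNReal.ofReal_le_iff_le_toReal hfin).mp h1
    rw [U.integral_switchGain hX hγ.ne', ← hN] at h2
    have h3 := U.rate_le_one hX 0
    have h4 := U.rate_nonneg (μ := μ) (X := X) ((K + 1 : ℕ) * mesh t K)
    have hsum : 0 ≤ ∑ j ∈ Finset.range (K + 1), (U.rate μ X (j * mesh t K) - γ) :=
      (pos_of_mul_pos_right h0 hpos.le).le
    have h5 : mesh t K * Real.exp (-(mesh t K / γ)) ≤ γ * (1 - Real.exp (-(mesh t K / γ))) := by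
      have h6 := mul_le_mul_of_nonneg_right (Real.add_one_le_exp ((mesh t K : ℝ) / γ))
        (Real.exp_pos (-(mesh t K / γ))).le
      rw [← Real.exp_add, add_neg_cancel, Real.exp_zero] at h6
      have h7 := mul_le_mul_of_nonneg_left h6 hγ.le
      have h8 : γ * ((mesh t K / γ + 1) * Real.exp (-(mesh t K / γ))) =
          mesh t K * Real.exp (-(mesh t K / γ)) + γ * Real.exp (-(mesh t K / γ)) := by
        field_simp
      linarith
    calc Real.exp (-(mesh t K / γ)) * S K
        = (mesh t K * Real.exp (-(mesh t K / γ))) *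
            ∑ j ∈ Finset.range (K + 1), (U.rate μ X (j * mesh t K) - γ) := by
          rw [hS]
          ring
      _ ≤ (γ * (1 - Real.exp (-(mesh t K / γ)))) *
            ∑ j ∈ Finset.range (K + 1), (U.rate μ X (j * mesh t K) - γ) :=
          mul_le_mul_of_nonneg_right h5 hsum
      _ = γ * ((1 - Real.exp (-(mesh t K / γ))) *
            ∑ j ∈ Finset.range (K + 1), (U.rate μ X (j * mesh t K) - γ)) := by ring
      _ ≤ γ * (N + 1) := mul_le_mul_of_nonneg_left (by linarith) hγ.le
  have hmesh : Tendsto (fun K => (mesh t K : ℝ)) atTop (𝓝 0) :=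
    NNReal.tendsto_coe.mpr (tendsto_mesh t)
  have hexp : Tendsto (fun K => Real.exp (-(mesh t K / γ))) atTop (𝓝 1) := by
    have h1 := (hmesh.div_const γ).neg.rexp
    simpa using h1
  -- `S` samples left endpoints, whereas `tendsto_expectedReward` samples right ones; the
  -- discrepancy is one mesh width times the difference of the end values.
  have hSeq : ∀ K, S K = (mesh t K : ℝ) *
      ∑ j ∈ Finset.range (K + 1), U.rate μ X ((j + 1 : ℕ) * mesh t K) +
      mesh t K * (U.rate μ X 0 - U.rate μ X t) - γ * t := by
    intro K
    have h1 := Finset.sum_range_sub (fun j : ℕ => U.rate μ X (j * mesh t K)) (K + 1)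
    have hend : ((K + 1 : ℕ) : ℝ≥0) * mesh t K = t := by
      push_cast
      exact succ_mul_mesh t K
    rw [Finset.sum_sub_distrib, hend, Nat.cast_zero, zero_mul] at h1
    have h2 := coe_succ_mul_mesh t K
    rw [hS]
    simp only
    rw [Finset.sum_sub_distrib, Finset.sum_const, Finset.card_range, nsmul_eq_mul, ← h2]
    have h3 : ∑ j ∈ Finset.range (K + 1), U.rate μ X (j * mesh t K) =
        ∑ j ∈ Finset.range (K + 1), U.rate μ X ((j + 1 : ℕ) * mesh t K) -
          (U.rate μ X t - U.rate μ X 0) := by linarith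
    rw [h3]
    push_cast
    ring
  have hSlim : Tendsto S atTop (𝓝 (U.expectedReward μ X t - γ * t)) := by
    have h1 := ((U.tendsto_expectedReward hX ht).add
      (hmesh.mul_const (U.rate μ X 0 - U.rate μ X t))).sub_const (γ * t)
    rw [zero_mul, add_zero] at h1
    exact h1.congr fun K => (hSeq K).symm
  have hlim := hexp.mul hSlim
  have hfinal := le_of_tendsto hlim (Eventually.of_forall hbound)
  linarith

theorem expectedReward_le [IsProbabilityMeasure μ] (hX : IsChannelSystem γ μ ℱ X)
    (hγ0 : 0 < γ) (hγ1 : γ < 1) (U : Control n ℱ) {t : ℝ≥0} (ht : 0 < t) :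
    U.expectedReward μ X t ≤ (1 - (1 - γ) ^ n) * t + n * γ := by
  refine U.expectedReward_le_of_rate_le hX hγ0 n.cast_nonneg (fun s => ?_) ht
  have h1 := meanState_le hX (U.measurable_chan s) s
  have h2 := (abs_le.mp (hX.abs_probAllBad_sub_le hγ0 hγ1 s)).1
  rw [rate]
  linarith

theorem AlwaysGood.abs_rate_sub_le [IsProbabilityMeasure μ] {U : Control n ℱ}
    (hU : U.AlwaysGood X) (hX : IsChannelSystem γ μ ℱ X) (hγ0 : 0 < γ) (hγ1 : γ < 1) (s : ℝ≥0) :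
    |U.rate μ X s - (1 - (1 - γ) ^ n)| ≤ n * Real.exp (-(s / γ)) := by
  rw [rate, meanState_eq hX fun ω h => hU.state_eq_one h, abs_sub_comm]
  convert hX.abs_probAllBad_sub_le hγ0 hγ1 s using 2
  ring

theorem AlwaysGood.le_expectedReward [IsProbabilityMeasure μ] {U : Control n ℱ}
    (hU : U.AlwaysGood X) (hX : IsChannelSystem γ μ ℱ X) (hγ0 : 0 < γ) (hγ1 : γ < 1)
    {t : ℝ≥0} (ht : 0 < t) :
    (1 - (1 - γ) ^ n) * t - n * γ ≤ U.expectedReward μ X t := by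
  refine U.le_expectedReward_of_le_rate hX hγ0 n.cast_nonneg (fun s => ?_) ht
  linarith [(abs_le.mp (hU.abs_rate_sub_le hX hγ0 hγ1 s)).1]

/-- Fatou's lemma applied to `numSwitches_le`, with a bound on the mean gain uniform in the mesh. In
the constant `n + 2`, `n` comes from the exponentially decaying error of the rate, 1 from the
boundary term of the telescoping sum and 1 from time 0. -/
theorem AlwaysGood.expectedSwitches_le [IsProbabilityMeasure μ] {U : Control n ℱ}
    (hU : U.AlwaysGood X) (hX : IsChannelSystem γ μ ℱ X) (hn : 1 ≤ n) (hγ0 : 0 < γ) (hγ1 : γ < 1)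
    {t : ℝ≥0} (ht : 0 < t) :
    U.expectedSwitches μ t ≤ ENNReal.ofReal (t * ((1 - γ - (1 - γ) ^ n) / γ) + n + 2) := by
  set D := 1 - γ - (1 - γ) ^ n with hD
  have hD0 : 0 ≤ D := sub_nonneg.mpr (pow_one_sub_le hn hγ0 hγ1)
  have hgain : ∀ K, ∫ ω, U.switchGain X t K ω ∂μ ≤ t * (D / γ) + n + 1 := by
    intro K
    have hpos : (0 : ℝ) < mesh t K := mesh_pos ht K
    rw [U.integral_switchGain hX hγ0.ne']
    set e := Real.exp (-(mesh t K / γ)) with he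
    have he0 : 0 < e := Real.exp_pos _
    have he1 : e ≤ 1 := Real.exp_le_one_iff.mpr (neg_nonpos.mpr (by positivity))
    have hex : 1 - e ≤ mesh t K / γ := by linarith [Real.add_one_le_exp (-(mesh t K / γ))]
    have hsum : ∑ j ∈ Finset.range (K + 1), (U.rate μ X (j * mesh t K) - γ) ≤
        (K + 1) * D + n * ∑ j ∈ Finset.range (K + 1), e ^ j := by
      have h1 : ∀ j ∈ Finset.range (K + 1), U.rate μ X (j * mesh t K) - γ ≤ D + n * e ^ j := by
        intro j _
        have h2 := (abs_le.mp (hU.abs_rate_sub_le hX hγ0 hγ1 (j * mesh t K))).2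
        have h3 : Real.exp (-(((j : ℝ≥0) * mesh t K : ℝ≥0) / γ)) = e ^ j := by
          rw [he, ← Real.exp_nat_mul]
          congr 1
          push_cast
          ring
        rw [h3] at h2
        linarith
      refine (Finset.sum_le_sum h1).trans (le_of_eq ?_)
      rw [Finset.sum_add_distrib, ← Finset.mul_sum, Finset.sum_const, Finset.card_range,
        nsmul_eq_mul]
      push_cast
      ring
    have hgeom := mul_neg_geom_sum e (K + 1)
    have hmain := mul_le_mul_of_nonneg_left hsum (sub_nonneg.mpr he1)
    have hDt : (1 - e) * ((K + 1) * D) ≤ t * (D / γ) := by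
      have h1 := mul_le_mul_of_nonneg_right hex (by positivity : (0 : ℝ) ≤ (K + 1) * D)
      have h2 := coe_succ_mul_mesh t K
      refine h1.trans (le_of_eq ?_)
      rw [← h2]
      ring
    have hn0 : (n : ℝ) * ((1 - e) * ∑ j ∈ Finset.range (K + 1), e ^ j) ≤ n := by
      rw [hgeom]
      exact mul_le_of_le_one_right n.cast_nonneg (by linarith [pow_pos he0 (K + 1)])
    have h3 := U.rate_le_one hX ((K + 1 : ℕ) * mesh t K)
    have h4 := U.rate_nonneg (μ := μ) (X := X) 0
    linarith
  have hlint : ∀ K, ∫⁻ ω, ENNReal.ofReal (U.switchGain X t K ω) ∂μ ≤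
      ENNReal.ofReal (t * (D / γ) + n + 1) := by
    intro K
    rw [← ofReal_integral_eq_lintegral_ofReal (U.integrable_switchGain hX t K)
      (Eventually.of_forall fun ω => hU.switchGain_nonneg t K ω)]
    exact ENNReal.ofReal_le_ofReal (hgain K)
  have hB : 0 ≤ t * (D / γ) + n + 1 := by positivity
  calc U.expectedSwitches μ t
      ≤ ∫⁻ ω, (1 + liminf (fun K => ENNReal.ofReal (U.switchGain X t K ω)) atTop) ∂μ :=
        lintegral_mono fun ω => hU.numSwitches_le hX ht ω
    _ = 1 + ∫⁻ ω, liminf (fun K => ENNReal.ofReal (U.switchGain X t K ω)) atTop ∂μ := by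
        rw [lintegral_add_left measurable_const, lintegral_const, measure_univ, one_mul]
    _ ≤ 1 + liminf (fun K => ∫⁻ ω, ENNReal.ofReal (U.switchGain X t K ω) ∂μ) atTop := by
        refine add_le_add_right (lintegral_liminf_le' fun K => ?_) 1
        exact (U.integrable_switchGain hX t K).aemeasurable.ennreal_ofReal
    _ ≤ 1 + ENNReal.ofReal (t * (D / γ) + n + 1) := by
        refine add_le_add_right ?_ 1
        refine (liminf_le_liminf (Eventually.of_forall hlint)).trans ?_
        rw [liminf_const]
    _ = ENNReal.ofReal (t * (D / γ) + n + 2) := by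
        rw [← ENNReal.ofReal_one, ← ENNReal.ofReal_add zero_le_one hB]
        congr 1
        ring

theorem NeverSwitches.chan_eq {U : Control n ℱ} (hU : U.NeverSwitches) (t : ℝ≥0) :
    U.chan t = U.init := by
  funext ω
  rw [← U.before_zero ω, ← hU 0 ω]
  by_contra hne
  obtain ⟨s, -, -, hs⟩ := U.exists_switch (zero_le (a := t)) (Ne.symm hne)
  exact hs (hU s ω).symm

theorem NeverSwitches.expectedSwitches_eq_zero {U : Control n ℱ} (hU : U.NeverSwitches)
    (t : ℝ≥0) : U.expectedSwitches μ t = 0 := by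
  have h : ∀ ω, U.numSwitches t ω = 0 := by
    intro ω
    rw [numSwitches, Set.encard_eq_zero, Set.eq_empty_iff_forall_notMem]
    exact fun s hs => hs.2 (hU s ω).symm
  simp [expectedSwitches, h]

theorem NeverSwitches.abs_rate_sub_le [IsProbabilityMeasure μ] {U : Control n ℱ}
    (hU : U.NeverSwitches) (hX : IsChannelSystem γ μ ℱ X) (hγ0 : 0 < γ) (hγ1 : γ < 1) (s : ℝ≥0) :
    |U.rate μ X s - γ| ≤ Real.exp (-(s / γ)) := by
  rw [rate, hU.chan_eq]
  exact hX.abs_meanState_sub_le hγ0 hγ1 s U.init_measurable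

theorem payoff_eq_coe (U : Control n ℱ) (c : ℝ) {t : ℝ≥0} (hfin : U.expectedSwitches μ t ≠ ⊤) :
    ((U.expectedReward μ X t : EReal) - (c : EReal) * (U.expectedSwitches μ t : EReal)) /
      ((t : ℝ) : EReal) =
    (((U.expectedReward μ X t - c * (U.expectedSwitches μ t).toReal) / t : ℝ) : EReal) := by
  rw [← ENNReal.coe_toNNReal hfin, EReal.coe_nnreal_eq_coe_real, ENNReal.coe_toReal]
  push_cast
  rfl

/-- The case `c = 0` is separate because `0 * ⊤ = 0` in `EReal`: infinitely many expected switches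
are then free, whereas for `c > 0` they make the payoff `⊥`. -/
theorem avgReward_le {U : Control n ℱ} {c : ℝ} (hc : 0 ≤ c) {L C : ℝ}
    (hfin : ∀ t, 0 < t → U.expectedSwitches μ t ≠ ⊤ →
      U.expectedReward μ X t - c * (U.expectedSwitches μ t).toReal ≤ L * t + C)
    (hzero : c = 0 → ∀ t, 0 < t → U.expectedReward μ X t ≤ L * t + C) :
    U.avgReward μ X c ≤ (L : EReal) := by
  have hlim : Tendsto (fun t : ℝ≥0 => ((L + C / (t : ℝ) : ℝ) : EReal)) atTop (𝓝 (L : EReal)) :=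
    (continuous_coe_real_ereal.tendsto L).comp (tendsto_add_div L C)
  rw [← hlim.liminf_eq]
  refine liminf_le_liminf ?_
  filter_upwards [eventually_gt_atTop 0] with t ht
  have htpos : (0 : ℝ) < t := ht
  have hdiv : ∀ r : ℝ, r ≤ L * t + C → ((r / t : ℝ) : EReal) ≤ ((L + C / t : ℝ) : EReal) := by
    intro r hr
    rw [EReal.coe_le_coe_iff, div_le_iff₀ htpos, add_mul, div_mul_cancel₀ _ htpos.ne']
    exact hr
  by_cases htop : U.expectedSwitches μ t = ⊤
  · rcases hc.eq_or_lt with rfl | hcpos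
    · rw [EReal.coe_zero, zero_mul, sub_zero, ← EReal.coe_div]
      exact hdiv _ (hzero rfl t ht)
    · rw [htop, EReal.coe_ennreal_top, EReal.coe_mul_top_of_pos hcpos, EReal.sub_top,
        EReal.bot_div_of_pos_ne_top (by exact_mod_cast htpos) (EReal.coe_ne_top _)]
      exact bot_le
  · rw [payoff_eq_coe U c htop]
    exact hdiv _ (hfin t ht htop)

theorem avgReward_eq {U : Control n ℱ} {c L C : ℝ}
    (hfin : ∀ t, 0 < t → U.expectedSwitches μ t ≠ ⊤)
    (habs : ∀ t : ℝ≥0, 0 < t →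
      |U.expectedReward μ X t - c * (U.expectedSwitches μ t).toReal - L * t| ≤ C) :
    U.avgReward μ X c = (L : EReal) := by
  have hreal : Tendsto (fun t : ℝ≥0 => (U.expectedReward μ X t -
      c * (U.expectedSwitches μ t).toReal) / (t : ℝ)) atTop (𝓝 L) := by
    refine tendsto_of_tendsto_of_tendsto_of_le_of_le' (tendsto_add_div L (-C))
      (tendsto_add_div L C) ?_ ?_
    all_goals
      filter_upwards [eventually_gt_atTop 0] with t ht
      have htpos : (0 : ℝ) < t := ht
      obtain ⟨h1, h2⟩ := abs_le.mp (habs t ht)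
    · rw [le_div_iff₀ htpos, add_mul, div_mul_cancel₀ _ htpos.ne']
      linarith
    · rw [div_le_iff₀ htpos, add_mul, div_mul_cancel₀ _ htpos.ne']
      linarith
  have hlim := (continuous_coe_real_ereal.tendsto L).comp hreal
  refine (hlim.congr' ?_).liminf_eq
  filter_upwards [eventually_gt_atTop 0] with t ht
  exact (payoff_eq_coe U c (hfin t ht)).symm

theorem NeverSwitches.avgReward_eq [IsProbabilityMeasure μ] {U : Control n ℱ}
    (hU : U.NeverSwitches) (hX : IsChannelSystem γ μ ℱ X) (hγ0 : 0 < γ) (hγ1 : γ < 1) (c : ℝ) :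
    U.avgReward μ X c = (γ : EReal) := by
  have hs : ∀ t, U.expectedSwitches μ t = 0 := hU.expectedSwitches_eq_zero
  refine Control.avgReward_eq (C := 1 * γ) (fun t _ => by simp [hs]) fun t ht => ?_
  have h1 := U.expectedReward_le_of_rate_le hX hγ0 (L := γ) zero_le_one (fun s => by
    linarith [(abs_le.mp (hU.abs_rate_sub_le hX hγ0 hγ1 s)).2]) ht
  have h2 := U.le_expectedReward_of_le_rate hX hγ0 (L := γ) zero_le_one (fun s => by
    linarith [(abs_le.mp (hU.abs_rate_sub_le hX hγ0 hγ1 s)).1]) ht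
  rw [hs, ENNReal.toReal_zero, mul_zero, sub_zero, abs_le]
  constructor <;> linarith

theorem AlwaysGood.avgReward_eq [IsProbabilityMeasure μ] {U : Control n ℱ}
    (hU : U.AlwaysGood X) (hX : IsChannelSystem γ μ ℱ X) (hn : 1 ≤ n) (hγ0 : 0 < γ) (hγ1 : γ < 1)
    {c : ℝ} (hc : 0 ≤ c) :
    U.avgReward μ X c =
      ((1 - (1 - γ) ^ n - c * ((1 - γ - (1 - γ) ^ n) / γ) : ℝ) : EReal) := by
  set D := (1 - γ - (1 - γ) ^ n) / γ with hD
  have hD0 : 0 ≤ D := div_nonneg (sub_nonneg.mpr (pow_one_sub_le hn hγ0 hγ1)) hγ0.le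
  have hle : ∀ t : ℝ≥0, 0 < t →
      U.expectedSwitches μ t ≤ ENNReal.ofReal (t * D + n + 2) := fun t ht =>
    hU.expectedSwitches_le hX hn hγ0 hγ1 ht
  have hfin : ∀ t : ℝ≥0, 0 < t → U.expectedSwitches μ t ≠ ⊤ := fun t ht =>
    ((hle t ht).trans_lt ENNReal.ofReal_lt_top).ne
  refine Control.avgReward_eq (C := n * γ + c * (n + 2)) hfin fun t ht => ?_
  have h1 : (U.expectedSwitches μ t).toReal ≤ t * D + n + 2 :=
    ENNReal.toReal_le_of_le_ofReal (by positivity) (hle t ht)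
  have h2 := U.expectedReward_le_switches hX hγ0 ht (hfin t ht)
  have h3 := U.expectedReward_le hX hγ0 hγ1 ht
  have h4 := hU.le_expectedReward hX hγ0 hγ1 ht
  -- Earning as much as `π^(a)` does already forces this many switches, by
  -- `expectedReward_le_switches`.
  have h5 : t * D - n - 1 ≤ (U.expectedSwitches μ t).toReal := by
    have h6 : γ * (t * D - n - 1) ≤ γ * (U.expectedSwitches μ t).toReal := by
      have h7 : γ * D = 1 - γ - (1 - γ) ^ n := mul_div_cancel₀ _ hγ0.ne'
      have h8 : γ * (t * D) = (1 - γ - (1 - γ) ^ n) * t := by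
        rw [← h7]
        ring
      linarith
    exact le_of_mul_le_mul_left h6 hγ0
  have h9 := mul_le_mul_of_nonneg_left h1 hc
  have h10 := mul_le_mul_of_nonneg_left h5 hc
  rw [abs_le]
  constructor <;> linarith

theorem avgReward_le_of_le_cost [IsProbabilityMeasure μ] (hX : IsChannelSystem γ μ ℱ X)
    (hγ0 : 0 < γ) {c : ℝ} (hc : γ ≤ c) (U : Control n ℱ) :
    U.avgReward μ X c ≤ (γ : EReal) := by
  refine avgReward_le (C := γ) (hγ0.le.trans hc) (fun t ht hfin => ?_) fun h => ?_
  · have h1 := U.expectedReward_le_switches hX hγ0 ht hfin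
    have h2 := mul_le_mul_of_nonneg_right hc
      (ENNReal.toReal_nonneg (a := U.expectedSwitches μ t))
    linarith
  · linarith

/-- For two channels, the bound for switching cost `c < γ` interpolates between the bounds for
the switching costs `0` and `γ`. -/
theorem avgReward_le_of_cost_lt [IsProbabilityMeasure μ] {X : Fin 2 → ℝ≥0 → Ω → Fin 2}
    (hX : IsChannelSystem γ μ ℱ X) (hγ0 : 0 < γ) (hγ1 : γ < 1) {c : ℝ} (hc0 : 0 ≤ c) (hc : c < γ)
    (U : Control 2 ℱ) :
    U.avgReward μ X c ≤
      ((1 - (1 - γ) ^ 2 - c * ((1 - γ - (1 - γ) ^ 2) / γ) : ℝ) : EReal) := by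
  have hq : (1 - γ - (1 - γ) ^ 2) / γ = 1 - γ := by
    field_simp
    ring
  rw [hq]
  have hbound : ∀ t, 0 < t → U.expectedReward μ X t ≤ (1 - (1 - γ) ^ 2) * t + 2 * γ := by
    intro t ht
    exact_mod_cast U.expectedReward_le hX hγ0 hγ1 ht
  refine avgReward_le (C := 2 * γ) hc0 (fun t ht hfin => ?_) fun h t ht => ?_
  · have h1 := U.expectedReward_le_switches hX hγ0 ht hfin
    have h2 := hbound t ht
    set R := U.expectedReward μ X t
    set N := (U.expectedSwitches μ t).toReal
    -- Uses `γ (R - c N) = c (R - γ N) + (γ - c) R`, with both coefficients `c` and `γ - c`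
    -- nonnegative.
    have h3 := mul_le_mul_of_nonneg_left h1 hc0
    have h4 := mul_le_mul_of_nonneg_left h2 (sub_nonneg.mpr hc.le)
    have h5 : 0 ≤ c * γ := mul_nonneg hc0 hγ0.le
    refine le_of_mul_le_mul_left ?_ hγ0
    linarith
  · rw [h, zero_mul, sub_zero]
    exact hbound t ht

end Control

end AverageReward

end Channels

end

/-! ### The main theorem. -/

open Channels
theorem theorem1 {Ω : Type*} [m : MeasurableSpace Ω] (μ : Measure Ω) [IsProbabilityMeasure μ]
    (ℱ : Filtration ℝ≥0 m) (n : ℕ) (hn : 1 ≤ n) (γ c : ℝ) (hγ0 : 0 < γ) (hγ1 : γ < 1)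
    (hc : 0 ≤ c) (X : Fin n → ℝ≥0 → Ω → Fin 2) (hX : IsChannelSystem γ μ ℱ X) :
    -- both policies can be followed from every initial channel
    (∀ u₀ : Ω → Fin n, Measurable[ℱ 0] u₀ →
      (∃ U : Control n ℱ, U.init = u₀ ∧ U.AlwaysGood X) ∧
      (∃ U : Control n ℱ, U.init = u₀ ∧ U.NeverSwitches)) ∧
    -- the optimal choice between the two policies
    (∀ Ua Us : Control n ℱ, Ua.AlwaysGood X → Us.NeverSwitches →
      (c < γ → Us.avgReward μ X c ≤ Ua.avgReward μ X c) ∧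
      (c < γ → 2 ≤ n → Us.avgReward μ X c < Ua.avgReward μ X c) ∧
      (γ ≤ c → Ua.avgReward μ X c ≤ Us.avgReward μ X c)) ∧
    -- the expected average reward under the better policy
    (∀ U : Control n ℱ, U.FollowsPiStar X γ c → U.avgReward μ X c = (gStar n γ c : EReal)) ∧
    -- for two channels, this policy is optimal among all policies
    (n = 2 → ∀ U : Control n ℱ, U.FollowsPiStar X γ c →
      ∀ V : Control n ℱ, V.avgReward μ X c ≤ U.avgReward μ X c) := by
  have hcmp := pow_one_sub_le hn hγ0 hγ1
  -- The advantage of `π^(a)` over `π^(s)` factorises, so its sign for `c < γ` can be read off; the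
  -- first factor is positive once `n ≥ 2`.
  have hdiff : 1 - (1 - γ) ^ n - c * ((1 - γ - (1 - γ) ^ n) / γ) - γ =
      (1 - γ - (1 - γ) ^ n) * (1 - c / γ) := by
    field_simp
    ring
  refine ⟨fun u₀ hu₀ => ⟨exists_alwaysGood hX hu₀, exists_neverSwitches hu₀⟩,
    fun Ua Us ha hs => ⟨fun hcγ => ?_, fun hcγ hn2 => ?_, fun hcγ => ?_⟩, fun U hU => ?_, ?_⟩
  · rw [ha.avgReward_eq hX hn hγ0 hγ1 hc, hs.avgReward_eq hX hγ0 hγ1, EReal.coe_le_coe_iff,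
      ← sub_nonneg, hdiff]
    exact mul_nonneg (sub_nonneg.mpr hcmp) (sub_nonneg.mpr ((div_le_one hγ0).mpr hcγ.le))
  · rw [ha.avgReward_eq hX hn hγ0 hγ1 hc, hs.avgReward_eq hX hγ0 hγ1, EReal.coe_lt_coe_iff,
      ← sub_pos, hdiff]
    have hlt : (1 - γ) ^ n < 1 - γ :=
      pow_lt_self_of_lt_one₀ (by linarith) (by linarith) (by omega)
    exact mul_pos (sub_pos.mpr hlt) (sub_pos.mpr ((div_lt_one hγ0).mpr hcγ))
  · rw [hs.avgReward_eq hX hγ0 hγ1]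
    exact Ua.avgReward_le_of_le_cost hX hγ0 hcγ
  · rcases lt_or_ge c γ with hcγ | hcγ
    · rw [(hU.1 hcγ).avgReward_eq hX hn hγ0 hγ1 hc, gStar, if_pos hcγ]
    · rw [(hU.2 hcγ).avgReward_eq hX hγ0 hγ1, gStar, if_neg (not_lt.mpr hcγ)]
  · rintro rfl U hU V
    rcases lt_or_ge c γ with hcγ | hcγ
    · rw [(hU.1 hcγ).avgReward_eq hX hn hγ0 hγ1 hc]
      exact V.avgReward_le_of_cost_lt hX hγ0 hγ1 hc hcγ
    · rw [(hU.2 hcγ).avgReward_eq hX hγ0 hγ1]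
      exact V.avgReward_le_of_le_cost hX hγ0 hcγ
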